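/- Let $U=[n]$. In the problem $\mathrm{SetCover}_{\alpha}$, Alice holds $m$ sets $S_1,\dots,S_m\subseteq[n]$ and Bob holds one set $T\subseteq[n]$; Alice sends Bob a single message, and Bob must output (the indices of) at most $\alpha\cdot\mathrm{opt}$ of these $m+1$ sets that cover $[n]$, where $\mathrm{opt}$ is the minimum number of these sets that cover $[n]$, together with a certificate of covering: for each $e\in[n]$, the index of one of the chosen sets that contains $e$. For $\beta>0$ let $\mathcal D_{\mathrm{apx}}(\beta)$ be the following distribution on inputs. Alice receives $m$ sets $S_1,\dots,S_m$ chosen independently and uniformly at random among the subsets of $[n]$ with $\lfloor n/(10\beta)\rfloor$ elements. An index $i^*\in[m]$ is chosen uniformly at random (and told to nobody), and Bob receives $T=[n]\setminus E$, where $E$ is uniformly random among the subsets of $[n]$ with $|E|=\lfloor 2\beta\log_2 m\rfloor$ and $|E\setminus S_{i^*}|=1$. For a distribution $\mathcal D$ on inputs, let $\mathrm{CC}^{\delta}_{\mathcal D}(P)$ be the minimum, over all one-way protocols (with public and private randomness) whose output violates $P$ with probability at most $\delta$ over the input from $\mathcal D$ and the randomness of the protocol, of the worst-case number of bits sent by Alice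 on inputs in the support of $\mathcal D$ (it is $\infty$ if there is no such protocol). **Theorem.** For every constant $0<\delta<1/2$ there is a constant $c=c(\delta)>0$ such that the following holds. Let $\alpha=\alpha(n)\ge 1$ with $\alpha=o(\sqrt n/\log n)$, and let $m=m(n)$ be polynomially bounded in $n$ with $m=\Omega(\alpha\log n)$. Then for all sufficiently large $n$, $$\mathrm{CC}^{\delta}_{\mathcal D_{\mathrm{apx}}(3\alpha)}(\mathrm{SetCover}_{\alpha})\;\ge\; c\cdot\frac{mn}{\alpha},$$ that is, the one-way two-player communication complexity of $\alpha$-approximating set cover on this hard distribution is $\Omega(mn/\alpha)$. -/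

import Mathlib

open MeasureTheory Filter Asymptotics
open scoped ENNReal Topology

/-! ## One-way two-player communication -/

/-- A randomized one-way protocol. Alice holds `x : X`, Bob holds `y : Y`. There is a public random
source `Pub` seen by both players, and private random sources `PrivA`, `PrivB`; the three sources
are independent. Alice sends one bit string and Bob answers with an element of `Z`. -/
structure OneWayProtocol (X Y Z : Type) where
  Pub : Type
  PrivA : Type
  PrivB : Type
  [spacePub : MeasurableSpace Pub]
  [spaceA : MeasurableSpace PrivA]
  [spaceB : MeasurableSpace PrivB]
  pub : Measure Pub
  privA : Measure PrivA
  privB : Measure PrivB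
  [probPub : IsProbabilityMeasure pub]
  [probA : IsProbabilityMeasure privA]
  [probB : IsProbabilityMeasure privB]
  /-- Alice's message. -/
  msg : X → Pub → PrivA → List Bool
  /-- Bob's answer. -/
  out : List Bool → Y → Pub → PrivB → Z
  measurable_msg : ∀ (x : X) (s : Set (List Bool)),
    MeasurableSet {ω : Pub × PrivA | msg x ω.1 ω.2 ∈ s}
  measurable_out : ∀ (w : List Bool) (y : Y) (s : Set Z),
    MeasurableSet {ω : Pub × PrivB | out w y ω.1 ω.2 ∈ s}

namespace OneWayProtocol

variable {X Y Z : Type}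

attribute [instance] spacePub spaceA spaceB probPub probA probB

/-- Bob's answer on the inputs `x`, `y` when the random sources show `ω`. -/
def run (π : OneWayProtocol X Y Z) (x : X) (y : Y) (ω : π.Pub × π.PrivA × π.PrivB) : Z :=
  π.out (π.msg x ω.1 ω.2.1) y ω.1 ω.2.2

/-- The probability, over the inputs `(x, y) ∼ D` and the independent randomness of the protocol,
that Bob's answer `z` does not satisfy `P x y z`. -/
noncomputable def error (π : OneWayProtocol X Y Z) (P : X → Y → Z → Prop) (D : PMF (X × Y)) :
    ℝ≥0∞ :=
  ∑' p : X × Y, D p *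
    (π.pub.prod (π.privA.prod π.privB)) {ω | ¬ P p.1 p.2 (π.run p.1 p.2 ω)}

/-- The communication cost: the worst-case length of Alice's message over the inputs in the
support of `D` and over all random choices. -/
noncomputable def cost (π : OneWayProtocol X Y Z) (D : PMF (X × Y)) : ℕ∞ :=
  ⨆ (p : X × Y) (_ : p ∈ D.support) (r : π.Pub) (a : π.PrivA), ((π.msg p.1 r a).length : ℕ∞)

end OneWayProtocol

/-- The one-way communication complexity of the relation `P` over the input distribution `D` with
error `δ`: the least communication cost of a `δ`-error protocol (`⊤` if there is none). -/
noncomputable def oneWayCC {X Y Z : Type} (P : X → Y → Z → Prop) (D : PMF (X × Y)) (δ : ℝ) : ℕ∞ :=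
  ⨅ (π : OneWayProtocol X Y Z) (_ : π.error P D ≤ ENNReal.ofReal δ), π.cost D

/-! ## Approximate set cover -/

/-- The sets of the family `A` with index in `C` cover the universe `U`. -/
def IsSetCover {ι U : Type} (A : ι → Finset U) (C : Finset ι) : Prop :=
  ∀ e : U, ∃ i ∈ C, e ∈ A i

/-- The minimum number of sets of the family `A` that cover the universe. It is only used next to
a cover of the universe, so that the minimum is over a nonempty set. -/
noncomputable def setCoverOpt {ι U : Type} (A : ι → Finset U) : ℕ :=
  sInf {k | ∃ C : Finset ι, IsSetCover A C ∧ C.card = k}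

/-- `C` together with the certificate `f` is a valid answer for `α`-approximating set cover: `C`
consists of at most `α · opt` sets, and each element `e` of the universe is covered by the set
`A (f e)`, which is one of the chosen sets. -/
def IsApproxCover {ι U : Type} (α : ℝ) (A : ι → Finset U) (C : Finset ι) (f : U → ι) : Prop :=
  (C.card : ℝ) ≤ α * (setCoverOpt A : ℝ) ∧ ∀ e : U, f e ∈ C ∧ e ∈ A (f e)

/-- The collection of the `m + 1` sets held by the two players: Alice's `S₁, …, Sₘ` (indices
`some i`) and Bob's single set `T` (index `none`). -/
def jointFamily {n m : ℕ} (S : Fin m → Finset (Fin n)) (T : Finset (Fin n)) :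
    Option (Fin m) → Finset (Fin n) :=
  fun j => j.elim T S

/-- The communication problem of `α`-approximating set cover on `m + 1` sets over the universe
`[n]`, where Alice holds `m` sets and Bob holds one set; Bob answers with a collection of indices
and a certificate of covering. -/
def SetCoverApx (n m : ℕ) (α : ℝ) (S : Fin m → Finset (Fin n)) (T : Finset (Fin n))
    (z : Finset (Option (Fin m)) × (Fin n → Option (Fin m))) : Prop :=
  IsApproxCover α (jointFamily S T) z.1 z.2

/-! ## The hard distribution -/

/-- Pick `a` uniformly at random from `s` and continue with `f a`. (If `s` is empty there is
nothing to pick, and the value is an arbitrary point mass.) -/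
noncomputable def pickThen {A B : Type} [Inhabited B] (s : Finset A) (f : A → PMF B) : PMF B :=
  open Classical in
  if h : s.Nonempty then (PMF.uniformOfFinset s h).bind f else PMF.pure default

/-- The subsets of `[n]` with `s` elements. -/
def subsetsOfCard (n s : ℕ) : Finset (Finset (Fin n)) :=
  Finset.univ.filter fun A => A.card = s

/-- The subsets `E` of `[n]` with `ℓ` elements, exactly one of which is outside of `A`. -/
def trapSets (n ℓ : ℕ) (A : Finset (Fin n)) : Finset (Finset (Fin n)) :=
  Finset.univ.filter fun E => E.card = ℓ ∧ (E \ A).card = 1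

/-- The hard distribution at scale `β`. Let `s = n / (10 β)` and `ℓ = 2 β log₂ m` (rounded down).
Alice gets `m` independent uniformly random `s`-subsets `S₁, …, Sₘ` of `[n]`, that is, a uniformly
random `m`-tuple of `s`-subsets. For a uniformly random index `i ∈ [m]`, Bob gets `[n] \ E`, where
`E` is a uniformly random `ℓ`-subset of `[n]` with `|E \ Sᵢ| = 1`. -/
noncomputable def Dapx (n m : ℕ) (β : ℝ) : PMF ((Fin m → Finset (Fin n)) × Finset (Fin n)) :=
  pickThen (Fintype.piFinset fun _ : Fin m => subsetsOfCard n ⌊(n : ℝ) / (10 * β)⌋₊) fun S =>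
    pickThen (Finset.univ : Finset (Fin m)) fun i =>
      pickThen (trapSets n ⌊2 * β * Real.logb 2 m⌋₊ (S i)) fun E =>
        PMF.pure (S, Eᶜ)

/-! ## Fixing the randomness of a protocol -/

namespace OneWayProtocol

/-! Fix the random sources to values with error no worse than average (`exists_run_error_le`), so
that the message is a function of Alice's sets. Call E a trap for S_i; Bob's difficulty is to locate
its single element outside S_i. Apart from two rare events, another S_j contains this element, so
opt ≤ 3, and no other S_j meets E in more than log₂ m elements (`trapAverage_uncovered_le`,
`trapAverage_overlap_le`). A correct answer then uses at most 3α sets, and T misses E, so at most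
half of E is certified by sets other than S_i; this half contains the outside element
(`sdiff_subset_trapGuess`). The message thus yields guesses of at most half of the trap that, on
average over i, catch the outside element with probability at least 1/2 + ε.

Such guesses need many messages (`le_log_card_messages`). Produce each S_i from a random bijection
of positions to [n] that has r pairs, one member inside S_i and one outside; the t-th trap is the
t-th pair plus b fixed inside positions. By symmetry its law is that of the hard distribution
(`trapAverage_eq_sum_arrangements`). Flipping pairs preserves all traps, so given the traps the mr
orientations are independent fair bits, and Massart's bound limits how well guesses determined by
one of |M| messages correlate with them (`sum_guessAdvantage_le`). Conversely, the inside member of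
a pair is exchangeable with the other inside elements of the trap, so a half-sized guess catching
the outside element too often must prefer it to its partner (`le_sum_guessAdvantage`). Together log
|M| ≥ ε² m r / 2, where r is of order n/α. -/

theorem measurableSet_run {X Y Z : Type} (π : OneWayProtocol X Y Z) (x : X) (y : Y) (s : Set Z) :
    MeasurableSet {ω | π.run x y ω ∈ s} := by
  -- Splitting by the message, of which there are countably many, separates Alice's measurability
  -- condition from Bob's.
  have h : {ω | π.run x y ω ∈ s} = ⋃ w : List Bool,
      ((fun ω : π.Pub × π.PrivA × π.PrivB => (ω.1, ω.2.1)) ⁻¹' {ω | π.msg x ω.1 ω.2 ∈ ({w} : Set _)}) ∩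
      ((fun ω : π.Pub × π.PrivA × π.PrivB => (ω.1, ω.2.2)) ⁻¹' {ω | π.out w y ω.1 ω.2 ∈ s}) := by
    ext ω
    simp [run]
  rw [h]
  refine MeasurableSet.iUnion fun w => MeasurableSet.inter ?_ ?_
  · exact (π.measurable_msg x {w}).preimage (by fun_prop)
  · exact (π.measurable_out w y s).preimage (by fun_prop)

/-- Some choice of the random sources does at least as well as the average. -/
theorem exists_run_error_le {X Y Z : Type} [Countable X] [Countable Y] (π : OneWayProtocol X Y Z)
    (P : X → Y → Z → Prop) (D : PMF (X × Y)) :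
    ∃ ω, ∑' p : X × Y, D p * ({p : X × Y | ¬ P p.1 p.2 (π.run p.1 p.2 ω)}.indicator 1 p : ℝ≥0∞)
      ≤ π.error P D := by
  let μ := π.pub.prod (π.privA.prod π.privB)
  have hm : ∀ p : X × Y, MeasurableSet {ω | ¬ P p.1 p.2 (π.run p.1 p.2 ω)} :=
    fun p => π.measurableSet_run p.1 p.2 {z | ¬ P p.1 p.2 z}
  have hf : ∀ p : X × Y, Measurable fun ω =>
      D p * ({ω | ¬ P p.1 p.2 (π.run p.1 p.2 ω)}.indicator 1 ω : ℝ≥0∞) :=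
    fun p => (measurable_one.indicator (hm p)).const_mul _
  obtain ⟨ω, hω⟩ := exists_le_lintegral (μ := μ)
    (f := fun ω => ∑' p : X × Y, D p * ({ω | ¬ P p.1 p.2 (π.run p.1 p.2 ω)}.indicator 1 ω : ℝ≥0∞))
    (Measurable.tsum hf).aemeasurable
  refine ⟨ω, ?_⟩
  rw [lintegral_tsum fun p => (hf p).aemeasurable] at hω
  refine le_trans (le_of_eq ?_) (hω.trans (le_of_eq ?_))
  · rfl
  · refine tsum_congr fun p => ?_
    rw [lintegral_const_mul _ (measurable_one.indicator (hm p)), lintegral_indicator_one (hm p)]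

end OneWayProtocol

/-! ## Averages over the hard distribution -/

/-- The truth value of a proposition, as a real number. -/
noncomputable def truthValue (p : Prop) : ℝ := open Classical in if p then 1 else 0

theorem truthValue_of {p : Prop} (h : p) : truthValue p = 1 := if_pos h

theorem truthValue_of_not {p : Prop} (h : ¬ p) : truthValue p = 0 := if_neg h

theorem truthValue_nonneg (p : Prop) : 0 ≤ truthValue p := by
  unfold truthValue
  positivity

theorem truthValue_eq_ite (p : Prop) [Decidable p] : truthValue p = if p then 1 else 0 := by
  unfold truthValue
  congr

theorem sum_truthValue {γ : Type*} (X : Finset γ) (P : γ → Prop) [DecidablePred P] :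
    ∑ B ∈ X, truthValue (P B) = ((X.filter P).card : ℝ) := by
  simp only [truthValue_eq_ite, Finset.sum_boole]

theorem tsum_bind_mul {A B : Type} (p : PMF A) (f : A → PMF B) (h : B → ℝ≥0∞) :
    ∑' b, (p.bind f) b * h b = ∑' a, p a * ∑' b, f a b * h b := by
  simp_rw [PMF.bind_apply, ← ENNReal.tsum_mul_right, ← ENNReal.tsum_mul_left]
  rw [ENNReal.tsum_comm]
  simp_rw [mul_assoc]

/-- Converts one layer of a nested random choice into a finite real average; nonnegativity lets
`ENNReal.ofReal` pass through the sum. -/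
theorem tsum_pickThen_mul {A B : Type} [Inhabited B] {s : Finset A} (hs : s.Nonempty)
    (f : A → PMF B) (h : B → ℝ≥0∞) (H : A → ℝ) (H_nonneg : ∀ a ∈ s, 0 ≤ H a)
    (hH : ∀ a ∈ s, ∑' b, f a b * h b = ENNReal.ofReal (H a)) :
    ∑' b, pickThen s f b * h b = ENNReal.ofReal ((∑ a ∈ s, H a) / s.card) := by
  classical
  have hc : (0 : ℝ) < s.card := by exact_mod_cast hs.card_pos
  rw [pickThen, dif_pos hs, tsum_bind_mul, tsum_eq_sum (s := s)]
  · rw [div_eq_inv_mul, ENNReal.ofReal_mul (by positivity), ENNReal.ofReal_sum_of_nonneg H_nonneg,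
      Finset.mul_sum]
    refine Finset.sum_congr rfl fun a ha => ?_
    rw [hH a ha, PMF.uniformOfFinset_apply_of_mem hs ha, ENNReal.ofReal_inv_of_pos hc,
      ENNReal.ofReal_natCast]
  · intro a ha
    rw [PMF.uniformOfFinset_apply_of_notMem hs ha, zero_mul]

theorem mem_support_pickThen {A B : Type} [Inhabited B] {s : Finset A} {f : A → PMF B} {a : A}
    {b : B} (ha : a ∈ s) (hb : b ∈ (f a).support) : b ∈ (pickThen s f).support := by
  rw [pickThen, dif_pos ⟨a, ha⟩, PMF.mem_support_bind_iff]
  exact ⟨a, (PMF.mem_support_uniformOfFinset_iff _ _).2 ha, hb⟩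

/-- The input tuples of Alice in the hard distribution. -/
def aliceInputs (n m s : ℕ) : Finset (Fin m → Finset (Fin n)) :=
  Fintype.piFinset fun _ => subsetsOfCard n s

theorem mem_subsetsOfCard {n s : ℕ} {A : Finset (Fin n)} : A ∈ subsetsOfCard n s ↔ A.card = s := by
  simp [subsetsOfCard]

theorem mem_aliceInputs {n m s : ℕ} {S : Fin m → Finset (Fin n)} :
    S ∈ aliceInputs n m s ↔ ∀ i, (S i).card = s := by
  simp [aliceInputs, mem_subsetsOfCard]

theorem mem_trapSets {n ℓ : ℕ} {A E : Finset (Fin n)} :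
    E ∈ trapSets n ℓ A ↔ E.card = ℓ ∧ (E \ A).card = 1 := by
  simp [trapSets]

theorem tsum_Dapx_mul_indicator {n m s ℓ : ℕ} {β : ℝ} (hs : ⌊(n : ℝ) / (10 * β)⌋₊ = s)
    (hℓ : ⌊2 * β * Real.logb 2 m⌋₊ = ℓ) (hm : 0 < m) (hX : (aliceInputs n m s).Nonempty)
    (hT : ∀ A : Finset (Fin n), A.card = s → (trapSets n ℓ A).Nonempty)
    (Q : Set ((Fin m → Finset (Fin n)) × Finset (Fin n))) :
    ∑' p, Dapx n m β p * (Q.indicator 1 p : ℝ≥0∞) = ENNReal.ofReal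
      ((∑ S ∈ aliceInputs n m s, (∑ i, (∑ E ∈ trapSets n ℓ (S i), truthValue ((S, Eᶜ) ∈ Q)) /
        (trapSets n ℓ (S i)).card) / m) / (aliceInputs n m s).card) := by
  have : Nonempty (Fin m) := ⟨⟨0, hm⟩⟩
  subst hs hℓ
  unfold Dapx
  refine tsum_pickThen_mul hX _ _ _ (fun S _ => div_nonneg (Finset.sum_nonneg fun _ _ =>
    div_nonneg (Finset.sum_nonneg fun _ _ => truthValue_nonneg _) (Nat.cast_nonneg _))
    (Nat.cast_nonneg _)) fun S hS => ?_
  have := tsum_pickThen_mul (B := (Fin m → Finset (Fin n)) × Finset (Fin n))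
    (s := (Finset.univ : Finset (Fin m))) Finset.univ_nonempty
    (fun i => pickThen (trapSets n ⌊2 * β * Real.logb 2 m⌋₊ (S i)) fun E => PMF.pure (S, Eᶜ))
    (Q.indicator 1) (fun i => (∑ E ∈ trapSets n ⌊2 * β * Real.logb 2 m⌋₊ (S i),
      truthValue ((S, Eᶜ) ∈ Q)) / (trapSets n ⌊2 * β * Real.logb 2 m⌋₊ (S i)).card)
    (fun i _ => div_nonneg (Finset.sum_nonneg fun _ _ => truthValue_nonneg _)
      (Nat.cast_nonneg _)) fun i _ => ?_
  · simpa using this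
  · refine tsum_pickThen_mul (hT _ (mem_aliceInputs.1 hS i)) _ _ _
      (fun E _ => truthValue_nonneg _) fun E _ => ?_
    rw [tsum_eq_single (S, Eᶜ)]
    · by_cases h : (S, Eᶜ) ∈ Q <;> simp [h, truthValue]
    · intro b hb
      simp [PMF.pure_apply, hb]

/-- The cost bounds messages only on the support, so the inputs in use must be shown to lie in it.
-/
theorem mem_support_Dapx {n m s ℓ : ℕ} {β : ℝ} (hs : ⌊(n : ℝ) / (10 * β)⌋₊ = s)
    (hℓ : ⌊2 * β * Real.logb 2 m⌋₊ = ℓ) {S : Fin m → Finset (Fin n)}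
    (hS : S ∈ aliceInputs n m s) {i : Fin m} {E : Finset (Fin n)} (hE : E ∈ trapSets n ℓ (S i)) :
    (S, Eᶜ) ∈ (Dapx n m β).support := by
  subst hs hℓ
  exact mem_support_pickThen hS (mem_support_pickThen (Finset.mem_univ i)
    (mem_support_pickThen hE (by simp)))

/-! ## Counting messages -/

/-- The bit strings of length at most `k`. -/
def shortStrings (k : ℕ) : Finset (List Bool) :=
  (Finset.range (k + 1)).biUnion fun j =>
    (Finset.univ : Finset (List.Vector Bool j)).image List.Vector.toList

theorem mem_shortStrings {k : ℕ} {w : List Bool} (hw : w.length ≤ k) : w ∈ shortStrings k := by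
  simp only [shortStrings, Finset.mem_biUnion, Finset.mem_range, Finset.mem_image,
    Finset.mem_univ, true_and]
  exact ⟨w.length, by omega, ⟨w, rfl⟩, rfl⟩

theorem card_shortStrings_le (k : ℕ) : (shortStrings k).card ≤ 2 ^ (k + 1) := by
  refine Finset.card_biUnion_le.trans ?_
  calc ∑ j ∈ Finset.range (k + 1),
        ((Finset.univ : Finset (List.Vector Bool j)).image List.Vector.toList).card
      ≤ ∑ j ∈ Finset.range (k + 1), 2 ^ j := by
        refine Finset.sum_le_sum fun j _ => Finset.card_image_le.trans ?_
        simp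
    _ ≤ 2 ^ (k + 1) := by
        rw [Nat.geomSum_eq le_rfl]
        simp

/-! ## Guessing random bits from a short message -/

/-- The sign of a bit. -/
def bitSign (b : Bool) : ℝ := if b then 1 else -1

/-- The signs are independent, so the moment generating function factors into terms cosh (x a_j) ≤
exp (x² / 2). -/
theorem sum_exp_bitSign_le {ι : Type*} [Fintype ι] [DecidableEq ι] (a : ι → ℝ) (x : ℝ)
    (ha : ∀ j, |a j| ≤ 1) :
    ∑ z : ι → Bool, Real.exp (x * ∑ j, bitSign (z j) * a j) ≤
      2 ^ Fintype.card ι * Real.exp (x ^ 2 * Fintype.card ι / 2) := by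
  have h : ∑ z : ι → Bool, Real.exp (x * ∑ j, bitSign (z j) * a j) =
      ∏ j, (2 * Real.cosh (x * a j)) := by
    calc ∑ z : ι → Bool, Real.exp (x * ∑ j, bitSign (z j) * a j)
        = ∑ z : ι → Bool, ∏ j, Real.exp (x * (bitSign (z j) * a j)) := by
          simp_rw [Finset.mul_sum, Real.exp_sum]
      _ = ∏ j, ∑ b : Bool, Real.exp (x * (bitSign b * a j)) := by
          rw [Finset.prod_univ_sum, Fintype.piFinset_univ]
      _ = _ := by
          refine Finset.prod_congr rfl fun j _ => ?_
          rw [Real.cosh_eq]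
          simp [bitSign]
          ring
  rw [h, Finset.prod_mul_distrib, Finset.prod_const, Finset.card_univ]
  refine mul_le_mul_of_nonneg_left ?_ (by positivity)
  calc ∏ j, Real.cosh (x * a j) ≤ ∏ _j : ι, Real.exp (x ^ 2 / 2) := by
        refine Finset.prod_le_prod (fun j _ => (Real.cosh_pos _).le) fun j _ => ?_
        refine (Real.cosh_le_exp_half_sq _).trans (Real.exp_le_exp.2 ?_)
        have : (a j) ^ 2 ≤ 1 := (sq_le_one_iff_abs_le_one _).2 (ha j)
        rw [mul_pow]
        nlinarith [sq_nonneg x]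
    _ = Real.exp (x ^ 2 * Fintype.card ι / 2) := by
        rw [Finset.prod_const, Finset.card_univ, ← Real.exp_nat_mul]
        congr 1
        ring

/-- Massart's bound on the correlation with random bits of a guess that depends on a message. -/
theorem sum_bitSign_message_le {ι κ : Type*} [Fintype ι] [DecidableEq ι] (W : (ι → Bool) → κ)
    (M : Finset κ) (hW : ∀ z, W z ∈ M) (a : κ → ι → ℝ) (ha : ∀ w j, |a w j| ≤ 1) (x : ℝ) :
    x * ∑ z : ι → Bool, ∑ j, bitSign (z j) * a (W z) j ≤
      2 ^ Fintype.card ι * (Real.log M.card + x ^ 2 * Fintype.card ι / 2) := by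
  set N := Fintype.card ι
  set C := Real.log M.card + x ^ 2 * N / 2 with hC
  have hM : 0 < (M.card : ℝ) := by exact_mod_cast Finset.card_pos.2 ⟨_, hW fun _ => true⟩
  -- The term for the actual message is bounded by the sum over all messages in `M`; for a fixed
  -- message the guess no longer depends on `z`.
  have key : ∑ z : ι → Bool, Real.exp (x * ∑ j, bitSign (z j) * a (W z) j) ≤
      2 ^ N * Real.exp C := by
    calc ∑ z : ι → Bool, Real.exp (x * ∑ j, bitSign (z j) * a (W z) j)
        ≤ ∑ z : ι → Bool, ∑ w ∈ M, Real.exp (x * ∑ j, bitSign (z j) * a w j) := by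
          refine Finset.sum_le_sum fun z _ => ?_
          exact Finset.single_le_sum
            (f := fun w => Real.exp (x * ∑ j, bitSign (z j) * a w j))
            (fun w _ => (Real.exp_pos _).le) (hW z)
      _ = ∑ w ∈ M, ∑ z : ι → Bool, Real.exp (x * ∑ j, bitSign (z j) * a w j) :=
          Finset.sum_comm
      _ ≤ ∑ _w ∈ M, 2 ^ N * Real.exp (x ^ 2 * N / 2) :=
          Finset.sum_le_sum fun w _ => sum_exp_bitSign_le (a w) x (ha w)
      _ = 2 ^ N * Real.exp C := by
          rw [Finset.sum_const, nsmul_eq_mul, hC, Real.exp_add, Real.exp_log hM]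
          ring
  have hcard : ((Finset.univ : Finset (ι → Bool)).card : ℝ) = 2 ^ N := by
    simp [N]
  -- The inequality 1 + y ≤ exp y stands in for Jensen: `C` is chosen so that the mean of the
  -- shifted exponential is at most 1.
  have h2 : ∑ z : ι → Bool, (x * ∑ j, bitSign (z j) * a (W z) j - C + 1) ≤ 2 ^ N := by
    calc ∑ z : ι → Bool, (x * ∑ j, bitSign (z j) * a (W z) j - C + 1)
        ≤ ∑ z : ι → Bool, Real.exp (x * ∑ j, bitSign (z j) * a (W z) j) * Real.exp (-C) := by
          refine Finset.sum_le_sum fun z _ => ?_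
          rw [← Real.exp_add]
          linarith [Real.add_one_le_exp (x * ∑ j, bitSign (z j) * a (W z) j + -C)]
      _ ≤ 2 ^ N * Real.exp C * Real.exp (-C) := by
          rw [← Finset.sum_mul]
          exact mul_le_mul_of_nonneg_right key (Real.exp_pos _).le
      _ = 2 ^ N := by rw [mul_assoc, ← Real.exp_add]; simp
  rw [Finset.sum_add_distrib, Finset.sum_sub_distrib, Finset.sum_const, Finset.sum_const,
    nsmul_eq_mul, nsmul_eq_mul, hcard, ← Finset.mul_sum] at h2
  linarith

/-! ## Arrangements of the universe -/

/-- The positions of an arrangement of the universe: `r` pairs, each with one position inside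
(`true`) and one outside (`false`) of a set, `b + c` further positions inside and `d` further
positions outside of it. -/
abbrev Position (r b c d : ℕ) : Type := (Fin r × Bool) ⊕ (Fin b ⊕ (Fin c ⊕ Fin d))

namespace Position

variable {r b c d : ℕ}

/-- Whether a position is inside of the set. -/
def isInside : Position r b c d → Bool
  | .inl (_, x) => x
  | .inr (.inl _) => true
  | .inr (.inr (.inl _)) => true
  | .inr (.inr (.inr _)) => false

/-- Whether a position belongs to the trap of the `t`-th pair: the pair and the first `b` further
inside positions. -/
def isProbe (t : Fin r) : Position r b c d → Bool
  | .inl (t', _) => t' = t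
  | .inr (.inl _) => true
  | .inr (.inr _) => false

variable (r b c d) in
/-- The inside positions. -/
def inside : Finset (Position r b c d) := Finset.univ.filter fun p => isInside p

/-- The positions of the trap of the `t`-th pair. -/
def probe (t : Fin r) : Finset (Position r b c d) := Finset.univ.filter fun p => isProbe t p

theorem mem_inside {p : Position r b c d} : p ∈ inside r b c d ↔ isInside p = true := by
  rw [inside, Finset.mem_filter, and_iff_right (Finset.mem_univ _)]

theorem mem_probe {t : Fin r} {p : Position r b c d} : p ∈ probe t ↔ isProbe t p = true := by
  rw [probe, Finset.mem_filter, and_iff_right (Finset.mem_univ _)]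

theorem inside_eq : inside r b c d =
    ((Finset.univ ×ˢ {true}).disjSum (Finset.univ.disjSum (Finset.univ.disjSum ∅))) := by
  ext p
  rcases p with ⟨t, x⟩ | p | p | p <;> simp [mem_inside, isInside]

theorem probe_eq (t : Fin r) : probe (b := b) (c := c) (d := d) t =
    (({t} ×ˢ Finset.univ).disjSum (Finset.univ.disjSum ∅)) := by
  ext p
  rcases p with ⟨t, x⟩ | p | p <;> simp [mem_probe, isProbe]
  cases x <;> simp

theorem card_inside : (inside r b c d).card = r + b + c := by
  simp [inside_eq]
  ring

theorem card_probe (t : Fin r) : (probe (b := b) (c := c) (d := d) t).card = b + 2 := by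
  simp [probe_eq]
  ring

theorem probe_sdiff_inside (t : Fin r) :
    probe (b := b) (c := c) (d := d) t \ inside r b c d = {.inl (t, false)} := by
  ext p
  rcases p with ⟨t, x⟩ | p | p | p <;> simp [mem_probe, isProbe, mem_inside, isInside]

/-- Exchange the two positions of each pair whose bit is `false`. -/
def flip (z : Fin r → Bool) : Equiv.Perm (Position r b c d) where
  toFun := Sum.map (fun p => (p.1, p.2 == z p.1)) id
  invFun := Sum.map (fun p => (p.1, p.2 == z p.1)) id
  left_inv p := by
    rcases p with ⟨t, x⟩ | p
    · cases x <;> cases h : z t <;> simp [h]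
    · rfl
  right_inv p := by
    rcases p with ⟨t, x⟩ | p
    · cases x <;> cases h : z t <;> simp [h]
    · rfl

/-- A trap does not reveal how its pair is oriented: flips change the inside set but no trap. -/
theorem map_flip_probe (z : Fin r → Bool) (t : Fin r) :
    (probe (b := b) (c := c) (d := d) t).map (flip z).toEmbedding = probe t := by
  refine Finset.eq_of_subset_of_card_le (fun p hp => ?_) (by simp)
  obtain ⟨q, hq, rfl⟩ := Finset.mem_map.1 hp
  rcases q with ⟨t, x⟩ | q <;> simpa [mem_probe, isProbe, flip] using hq

end Position

open Position

/-- The sets of inside elements of a tuple of arrangements. -/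
def insideSets {m n r b c d : ℕ} (g : Fin m → Position r b c d ≃ Fin n) (i : Fin m) :
    Finset (Fin n) :=
  (inside r b c d).map (g i).toEmbedding

/-- The trap of the `t`-th pair of an arrangement. -/
def trapOf {n r b c d : ℕ} (t : Fin r) (e : Position r b c d ≃ Fin n) : Finset (Fin n) :=
  (probe t).map e.toEmbedding

/-- Permute the positions of each arrangement. -/
def rearrange {m n r b c d : ℕ} (π : Fin m → Equiv.Perm (Position r b c d)) :
    (Fin m → Position r b c d ≃ Fin n) ≃ (Fin m → Position r b c d ≃ Fin n) where
  toFun g i := (π i).trans (g i)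
  invFun g i := (π i).symm.trans (g i)
  left_inv g := by funext i; ext; simp
  right_inv g := by funext i; ext; simp

theorem rearrange_apply {m n r b c d : ℕ} (π : Fin m → Equiv.Perm (Position r b c d))
    (g : Fin m → Position r b c d ≃ Fin n) (i : Fin m) (p : Position r b c d) :
    rearrange π g i p = g i (π i p) := rfl

theorem trapOf_rearrange {m n r b c d : ℕ} (π : Fin m → Equiv.Perm (Position r b c d))
    (g : Fin m → Position r b c d ≃ Fin n) (i : Fin m) (t : Fin r)
    (h : (probe t).map (π i).toEmbedding = probe t) :
    trapOf t (rearrange π g i) = trapOf t (g i) := by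
  have : (rearrange π g i).toEmbedding = (π i).toEmbedding.trans (g i).toEmbedding := rfl
  rw [trapOf, this, ← Finset.map_map, h, trapOf]

theorem insideSets_rearrange {m n r b c d : ℕ} (π : Fin m → Equiv.Perm (Position r b c d))
    (g : Fin m → Position r b c d ≃ Fin n)
    (h : ∀ i, (inside r b c d).map (π i).toEmbedding = inside r b c d) :
    insideSets (rearrange π g) = insideSets g := by
  funext i
  have : (rearrange π g i).toEmbedding = (π i).toEmbedding.trans (g i).toEmbedding := rfl
  rw [insideSets, this, ← Finset.map_map, h, insideSets]

theorem trapOf_mem_trapSets {m n r b c d : ℕ} (t : Fin r) (g : Fin m → Position r b c d ≃ Fin n)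
    (i : Fin m) : trapOf t (g i) ∈ trapSets n (b + 2) (insideSets g i) := by
  rw [mem_trapSets, trapOf, insideSets, ← Finset.map_sdiff, Finset.card_map, Finset.card_map,
    card_probe, probe_sdiff_inside]
  simp

theorem trapOf_sdiff_insideSets {m n r b c d : ℕ} (t : Fin r)
    (g : Fin m → Position r b c d ≃ Fin n) (i : Fin m) :
    trapOf t (g i) \ insideSets g i = {g i (.inl (t, false))} := by
  rw [trapOf, insideSets, ← Finset.map_sdiff, probe_sdiff_inside]
  simp

theorem insideSets_mem_aliceInputs {m n r b c d : ℕ} (g : Fin m → Position r b c d ≃ Fin n) :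
    insideSets g ∈ aliceInputs n m (r + b + c) := by
  simp [mem_aliceInputs, insideSets, card_inside]

/-- How much more the guess `L` likes the outside element of the `t`-th pair than the inside
element. -/
def guessAdvantage {n r b c d : ℕ} (e : Position r b c d ≃ Fin n) (t : Fin r)
    (L : Finset (Fin n)) : ℝ :=
  (if e (.inl (t, false)) ∈ L then 1 else 0) - (if e (.inl (t, true)) ∈ L then 1 else 0)

theorem abs_guessAdvantage_le {n r b c d : ℕ} (e : Position r b c d ≃ Fin n) (t : Fin r)
    (L : Finset (Fin n)) : |guessAdvantage e t L| ≤ 1 := by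
  unfold guessAdvantage
  split_ifs <;> norm_num

/-- A short message about a random tuple of sets does not help to find the outside elements of the
traps. -/
theorem sum_guessAdvantage_le {m n r b c d : ℕ} {κ : Type*}
    (W : (Fin m → Finset (Fin n)) → κ) (M : Finset κ)
    (hW : ∀ g : Fin m → Position r b c d ≃ Fin n, W (insideSets g) ∈ M)
    (L : κ → Fin m → Finset (Fin n) → Finset (Fin n)) (x : ℝ) :
    x * ∑ g : Fin m → Position r b c d ≃ Fin n, ∑ i, ∑ t,
        guessAdvantage (g i) t (L (W (insideSets g)) i (trapOf t (g i))) ≤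
      Fintype.card (Fin m → Position r b c d ≃ Fin n) *
        (Real.log M.card + x ^ 2 * (m * r : ℕ) / 2) := by
  let ι := Fin m × Fin r
  let G := Fin m → Position r b c d ≃ Fin n
  let act (z : ι → Bool) : G ≃ G := rearrange fun i => flip fun t => z (i, t)
  let T (g : G) : ℝ := ∑ i, ∑ t, guessAdvantage (g i) t (L (W (insideSets g)) i (trapOf t (g i)))
  -- Flipping by a fixed `z` permutes the arrangements, so averaging over `z` too is free; for a
  -- fixed arrangement the bits of `z` are then the only randomness.
  have hact : ∀ z, ∑ g, T (act z g) = ∑ g, T g := fun z => Equiv.sum_comp (act z) T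
  have htrap : ∀ z g i t, trapOf t (act z g i) = trapOf t (g i) := fun z g i t =>
    trapOf_rearrange _ g i t (map_flip_probe _ _)
  have hadv : ∀ z g i t A, guessAdvantage (act z g i) t A =
      bitSign (z (i, t)) * guessAdvantage (g i) t A := by
    intro z g i t A
    have h : ∀ b, act z g i (.inl (t, b)) = g i (.inl (t, b == z (i, t))) := fun _ => rfl
    simp only [guessAdvantage, h, bitSign]
    cases z (i, t) <;> simp
  have hz : ∀ g, x * ∑ z : ι → Bool, T (act z g) ≤
      2 ^ (m * r) * (Real.log M.card + x ^ 2 * (m * r : ℕ) / 2) := by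
    intro g
    have := sum_bitSign_message_le (fun z => W (insideSets (act z g))) M (fun z => hW _)
      (fun w (j : ι) => guessAdvantage (g j.1) j.2 (L w j.1 (trapOf j.2 (g j.1))))
      (fun w j => abs_guessAdvantage_le _ _ _) x
    have hcard : Fintype.card ι = m * r := by simp [ι]
    rw [hcard] at this
    refine le_of_eq_of_le ?_ this
    congr 1
    refine Finset.sum_congr rfl fun z _ => ?_
    rw [Fintype.sum_prod_type]
    simp only [T, htrap, hadv]
  have hsum : x * ∑ z : ι → Bool, ∑ g, T (act z g) = 2 ^ (m * r) * (x * ∑ g, T g) := by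
    simp only [hact]
    simp [ι]
    ring
  have htot : 2 ^ (m * r) * (x * ∑ g, T g) ≤ 2 ^ (m * r) * (Fintype.card G *
      (Real.log M.card + x ^ 2 * (m * r : ℕ) / 2)) := by
    rw [← hsum, Finset.sum_comm, Finset.mul_sum]
    refine (Finset.sum_le_sum fun g _ => hz g).trans (le_of_eq ?_)
    rw [Finset.sum_const, nsmul_eq_mul, Finset.card_univ]
    ring
  exact le_of_mul_le_mul_left htot (by positivity)

/-- The inside element of the pair is not distinguished from the other inside elements of the
trap. -/
theorem le_sum_guessAdvantage {m n r b c d : ℕ} (i : Fin m) (t : Fin r)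
    (L : (Fin m → Finset (Fin n)) → Finset (Fin n) → Finset (Fin n))
    (hL : ∀ S E, L S E ⊆ E ∧ 2 * (L S E).card ≤ E.card) :
    ((b : ℝ) + 2) * ∑ g : Fin m → Position r b c d ≃ Fin n,
        ((if g i (.inl (t, false)) ∈ L (insideSets g) (trapOf t (g i)) then 1 else 0) - 1 / 2) ≤
      (b + 1) * ∑ g : Fin m → Position r b c d ≃ Fin n,
        guessAdvantage (g i) t (L (insideSets g) (trapOf t (g i))) := by
  let G := Fin m → Position r b c d ≃ Fin n
  let I (p : Position r b c d) (g : G) : ℝ :=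
    if g i p ∈ L (insideSets g) (trapOf t (g i)) then 1 else 0
  -- Swapping the two inside positions in the `i`-th arrangement alone preserves all sets and the
  -- trap, hence the guess.
  have hswap : ∀ q : Fin b, ∑ g, I (.inr (.inl q)) g = ∑ g, I (.inl (t, true)) g := by
    intro q
    let π : Equiv.Perm (Position r b c d) := Equiv.swap (.inl (t, true)) (.inr (.inl q))
    have hin : (inside r b c d).map π.toEmbedding = inside r b c d := by
      refine Finset.eq_of_subset_of_card_le (fun p hp => ?_) (by simp)
      obtain ⟨p', hp', rfl⟩ := Finset.mem_map.1 hp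
      simp only [π, Equiv.coe_toEmbedding, Equiv.swap_apply_def]
      split_ifs
      · simp [mem_inside, isInside]
      · simp [mem_inside, isInside]
      · exact hp'
    have hpr : (probe t).map π.toEmbedding = probe t := by
      refine Finset.eq_of_subset_of_card_le (fun p hp => ?_) (by simp)
      obtain ⟨p', hp', rfl⟩ := Finset.mem_map.1 hp
      simp only [π, Equiv.coe_toEmbedding, Equiv.swap_apply_def]
      split_ifs
      · simp [mem_probe, isProbe]
      · simp [mem_probe, isProbe]
      · exact hp'
    let act : G ≃ G := rearrange fun j => if j = i then π else Equiv.refl _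
    have hins : ∀ g, insideSets (act g) = insideSets g := fun g => by
      refine insideSets_rearrange _ g fun j => ?_
      by_cases h : j = i
      · simp [h, hin]
      · simp [h]
    have htr : ∀ g, trapOf t (act g i) = trapOf t (g i) := fun g =>
      trapOf_rearrange _ g i t (by simpa using hpr)
    rw [← Equiv.sum_comp act]
    refine Finset.sum_congr rfl fun g _ => ?_
    have : act g i (.inr (.inl q)) = g i (.inl (t, true)) := by
      refine (rearrange_apply (fun j => if j = i then π else Equiv.refl _) g i _).trans ?_
      simp [π]
    simp only [I, hins, htr, this]
  -- On average, with `hswap`, this reads p_out + (b + 1) p_in ≤ (b + 2) / 2, which rearranges to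
  -- the claim.
  have hcount : ∀ g : G, I (.inl (t, false)) g + I (.inl (t, true)) g +
      ∑ q : Fin b, I (.inr (.inl q)) g ≤ (b + 2) / 2 := by
    intro g
    obtain ⟨h1, h2⟩ := hL (insideSets g) (trapOf t (g i))
    have hc : (trapOf t (g i)).card = b + 2 := by simp [trapOf, card_probe]
    have : ∑ p ∈ probe t, I p g = (L (insideSets g) (trapOf t (g i))).card := by
      simp only [I]
      rw [Finset.sum_boole, ← Finset.card_map (g i).symm.toEmbedding]
      congr 2
      ext p
      simp only [Finset.mem_filter, Finset.mem_map_equiv, Equiv.symm_symm]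
      refine ⟨fun h => h.2, fun h => ⟨?_, h⟩⟩
      have := h1 h
      rwa [trapOf, Finset.mem_map_equiv, Equiv.symm_apply_apply] at this
    have h3 : ∑ p ∈ probe t, I p g = I (.inl (t, false)) g + I (.inl (t, true)) g +
      ∑ q : Fin b, I (.inr (.inl q)) g := by
      rw [probe_eq, Finset.sum_disjSum, Finset.sum_disjSum]
      simp
      ring
    rw [← h3, this]
    rw [hc] at h2
    have : (2 * (L (insideSets g) (trapOf t (g i))).card : ℝ) ≤ b + 2 := by exact_mod_cast h2
    linarith
  have hsum := Finset.sum_le_sum fun g (_ : g ∈ (Finset.univ : Finset G)) => hcount g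
  rw [Finset.sum_add_distrib, Finset.sum_add_distrib, Finset.sum_comm] at hsum
  simp only [hswap] at hsum
  have e1 : ∑ g : G, ((if g i (.inl (t, false)) ∈ L (insideSets g) (trapOf t (g i)) then 1 else 0)
    - 1 / 2) = ∑ g, I (.inl (t, false)) g - ∑ _g : G, (1 / 2 : ℝ) := Finset.sum_sub_distrib ..
  have e2 : ∑ g : G, guessAdvantage (g i) t (L (insideSets g) (trapOf t (g i))) =
    ∑ g, I (.inl (t, false)) g - ∑ g, I (.inl (t, true)) g := Finset.sum_sub_distrib ..
  rw [e1, e2]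
  simp at hsum ⊢
  nlinarith

/-! ## Random arrangements give random traps -/

/-- Two pairs of finsets with the same intersection pattern are matched by a bijection. -/
theorem exists_equiv_map_eq {γ κ : Type*} [Fintype γ] [Fintype κ] [DecidableEq γ] [DecidableEq κ]
    (I P : Finset γ) (A E : Finset κ) (h : Fintype.card γ = Fintype.card κ)
    (hI : I.card = A.card) (hP : P.card = E.card) (hd : (P \ I).card = (E \ A).card) :
    ∃ e : γ ≃ κ, I.map e.toEmbedding = A ∧ P.map e.toEmbedding = E := by
  -- The given cardinalities determine all four cells of the Venn diagram; bijections of the cells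
  -- are then glued.
  have hPI : (I ∩ P).card = (A ∩ E).card := by
    have h1 := Finset.card_sdiff_add_card_inter P I
    have h2 := Finset.card_sdiff_add_card_inter E A
    rw [Finset.inter_comm I, Finset.inter_comm A]
    omega
  have hIP : (I \ P).card = (A \ E).card := by
    have h1 := Finset.card_sdiff_add_card_inter I P
    have h2 := Finset.card_sdiff_add_card_inter A E
    omega
  have hU : (I ∪ P)ᶜ.card = (A ∪ E)ᶜ.card := by
    have h1 := Finset.card_union_add_card_inter I P
    have h2 := Finset.card_union_add_card_inter A E
    rw [Finset.card_compl, Finset.card_compl]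
    omega
  let f : γ → Bool × Bool := fun p => (decide (p ∈ I), decide (p ∈ P))
  let g : κ → Bool × Bool := fun v => (decide (v ∈ A), decide (v ∈ E))
  have hc : ∀ c, Fintype.card { p // f p = c } = Fintype.card { v // g v = c } := by
    rintro ⟨x, y⟩
    rw [Fintype.card_subtype, Fintype.card_subtype]
    cases x <;> cases y
    · refine Eq.trans (congrArg _ ?_) (hU.trans (congrArg _ ?_)) <;> ext <;> simp [f, g]
    · refine Eq.trans (congrArg _ ?_) (hd.trans (congrArg _ ?_)) <;> ext <;> simp [f, g, and_comm]
    · refine Eq.trans (congrArg _ ?_) (hIP.trans (congrArg _ ?_)) <;> ext <;> simp [f, g]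
    · refine Eq.trans (congrArg _ ?_) (hPI.trans (congrArg _ ?_)) <;> ext <;> simp [f, g]
  let e : γ ≃ κ := Equiv.ofFiberEquiv fun c => Fintype.equivOfCardEq (hc c)
  have he : ∀ p, g (e p) = f p := fun p => Equiv.ofFiberEquiv_map _ p
  refine ⟨e, ?_, ?_⟩ <;> ext v
  · have := congrArg Prod.fst (he (e.symm v))
    simp only [Equiv.apply_symm_apply, f, g, decide_eq_decide] at this
    rw [Finset.mem_map_equiv, this]
  · have := congrArg Prod.snd (he (e.symm v))
    simp only [Equiv.apply_symm_apply, f, g, decide_eq_decide] at this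
    rw [Finset.mem_map_equiv, this]

theorem card_position (r b c d : ℕ) :
    Fintype.card (Position r b c d) = r + b + c + (r + d) := by
  simp
  ring

/-- A permutation of the universe carrying `A` to `A'` carries traps to traps. -/
theorem card_trapSets_le {n : ℕ} (ℓ : ℕ) {A A' : Finset (Fin n)} (h : A.card = A'.card) :
    (trapSets n ℓ A).card ≤ (trapSets n ℓ A').card := by
  obtain ⟨e, he, -⟩ := exists_equiv_map_eq A A A' A' rfl h h (by simp)
  refine Finset.card_le_card_of_injOn (fun E => E.map e.toEmbedding) (fun E hE => ?_)
    (Finset.map_injective _).injOn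
  have := mem_trapSets.1 hE
  simp only [Finset.mem_coe, mem_trapSets, Finset.card_map]
  rwa [← he, ← Finset.map_sdiff, Finset.card_map]

theorem card_trapSets_eq {n : ℕ} (ℓ : ℕ) {A A' : Finset (Fin n)} (h : A.card = A'.card) :
    (trapSets n ℓ A).card = (trapSets n ℓ A').card :=
  (card_trapSets_le ℓ h).antisymm (card_trapSets_le ℓ h.symm)

theorem trapSets_nonempty {n r b c d : ℕ} (hn : r + b + c + (r + d) = n) (t : Fin r)
    {A : Finset (Fin n)} (hA : A.card = r + b + c) : (trapSets n (b + 2) A).Nonempty := by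
  obtain ⟨e, he, -⟩ := exists_equiv_map_eq (inside r b c d) (inside r b c d) A A
    (by rw [card_position, hn, Fintype.card_fin]) (by rw [card_inside, hA])
    (by rw [card_inside, hA]) (by simp)
  have := trapOf_mem_trapSets t (fun _ : Fin 1 => e) 0
  rw [insideSets, he] at this
  exact ⟨_, this⟩

theorem nonempty_arrangement {m n r b c d : ℕ} (hn : r + b + c + (r + d) = n) :
    Nonempty (Fin m → Position r b c d ≃ Fin n) :=
  ⟨fun _ => Fintype.equivFinOfCardEq (by rw [card_position, hn])⟩

/-- Only the `i`-th arrangement has to match both a set and a trap; each of the others has to match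
just its set, so all can be chosen separately. -/
theorem exists_arrangement {m n r b c d : ℕ} (hn : r + b + c + (r + d) = n) (t : Fin r)
    {S : Fin m → Finset (Fin n)} (hS : S ∈ aliceInputs n m (r + b + c)) {i : Fin m}
    {E : Finset (Fin n)} (hE : E ∈ trapSets n (b + 2) (S i)) :
    ∃ g : Fin m → Position r b c d ≃ Fin n, insideSets g = S ∧ trapOf t (g i) = E := by
  rw [mem_aliceInputs] at hS
  rw [mem_trapSets] at hE
  have hc : Fintype.card (Position r b c d) = Fintype.card (Fin n) := by
    rw [card_position, hn, Fintype.card_fin]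
  obtain ⟨e, he1, he2⟩ := exists_equiv_map_eq (inside r b c d) (probe t) (S i) E hc
    (by rw [card_inside, hS]) (by rw [card_probe, hE.1])
    (by rw [probe_sdiff_inside, hE.2, Finset.card_singleton])
  have hex : ∀ j, ∃ e : Position r b c d ≃ Fin n, (inside r b c d).map e.toEmbedding = S j :=
    fun j => by
      obtain ⟨e, he, -⟩ := exists_equiv_map_eq (inside r b c d) (inside r b c d) (S j) (S j) hc
        (by rw [card_inside, hS]) (by rw [card_inside, hS]) (by simp)
      exact ⟨e, he⟩
  choose f hf using hex
  refine ⟨Function.update f i e, funext fun j => ?_, ?_⟩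
  · rw [insideSets]
    by_cases h : j = i
    · subst h
      rw [Function.update_self, he1]
    · rw [Function.update_of_ne h, hf]
  · rw [Function.update_self, trapOf, he2]

/-- The pairs of an input tuple and a trap for its `i`-th set. -/
def trapPairs (n m s ℓ : ℕ) (i : Fin m) : Finset ((Fin m → Finset (Fin n)) × Finset (Fin n)) :=
  (aliceInputs n m s ×ˢ Finset.univ).filter fun p => p.2 ∈ trapSets n ℓ (p.1 i)

theorem mem_trapPairs {n m s ℓ : ℕ} {i : Fin m}
    {p : (Fin m → Finset (Fin n)) × Finset (Fin n)} :
    p ∈ trapPairs n m s ℓ i ↔ p.1 ∈ aliceInputs n m s ∧ p.2 ∈ trapSets n ℓ (p.1 i) := by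
  simp [trapPairs]

theorem sum_trapPairs {n m s ℓ : ℕ} (i : Fin m)
    (h : (Fin m → Finset (Fin n)) → Finset (Fin n) → ℝ) :
    ∑ p ∈ trapPairs n m s ℓ i, h p.1 p.2 =
      ∑ S ∈ aliceInputs n m s, ∑ E ∈ trapSets n ℓ (S i), h S E :=
  Finset.sum_finset_product _ _ _ fun _ => mem_trapPairs

/-- Permute the universe underlying each set of a tuple. -/
def permuteSets {m n : ℕ} (τ : Fin m → Equiv.Perm (Fin n)) (S : Fin m → Finset (Fin n))
    (j : Fin m) : Finset (Fin n) :=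
  (S j).map (τ j).toEmbedding

theorem permuteSets_symm {m n : ℕ} (τ : Fin m → Equiv.Perm (Fin n))
    (S : Fin m → Finset (Fin n)) : permuteSets τ (permuteSets (fun j => (τ j).symm) S) = S := by
  funext j
  simp only [permuteSets, Finset.map_map]
  ext v
  simp

theorem mem_trapPairs_permute {n m s ℓ : ℕ} {i : Fin m} (τ : Fin m → Equiv.Perm (Fin n))
    {p : (Fin m → Finset (Fin n)) × Finset (Fin n)} (hp : p ∈ trapPairs n m s ℓ i) :
    (permuteSets τ p.1, p.2.map (τ i).toEmbedding) ∈ trapPairs n m s ℓ i := by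
  rw [mem_trapPairs, mem_aliceInputs, mem_trapSets] at *
  simp only [permuteSets, Finset.card_map, ← Finset.map_sdiff]
  exact hp

theorem sum_trapPairs_permute {n m s ℓ : ℕ} (i : Fin m) (τ : Fin m → Equiv.Perm (Fin n))
    (h : (Fin m → Finset (Fin n)) → Finset (Fin n) → ℝ) :
    ∑ p ∈ trapPairs n m s ℓ i, h (permuteSets τ p.1) (p.2.map (τ i).toEmbedding) =
      ∑ p ∈ trapPairs n m s ℓ i, h p.1 p.2 := by
  refine Finset.sum_nbij' (fun p => (permuteSets τ p.1, p.2.map (τ i).toEmbedding))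
    (fun p => (permuteSets (fun j => (τ j).symm) p.1, p.2.map (τ i).symm.toEmbedding))
    (fun p hp => mem_trapPairs_permute τ hp)
    (fun p hp => mem_trapPairs_permute (fun j => (τ j).symm) hp) ?_ ?_ fun p _ => rfl
  · intro p _
    refine Prod.ext (permuteSets_symm (fun j => (τ j).symm) p.1) ?_
    simp only [Finset.map_map]
    ext v
    simp
  · intro p _
    refine Prod.ext (permuteSets_symm τ p.1) ?_
    simp only [Finset.map_map]
    ext v
    simp

/-- The average over a random input tuple of sets of size `s` and a random trap of size `ℓ` for
its `i`-th set. -/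
noncomputable def trapAverage {n m : ℕ} (s ℓ : ℕ) (i : Fin m)
    (h : (Fin m → Finset (Fin n)) → Finset (Fin n) → ℝ) : ℝ :=
  (∑ S ∈ aliceInputs n m s, (∑ E ∈ trapSets n ℓ (S i), h S E) / (trapSets n ℓ (S i)).card) /
    (aliceInputs n m s).card

/-- The inside sets and the trap of a random arrangement are a random input and a random trap. -/
theorem trapAverage_eq_sum_arrangements {m n r b c d : ℕ} (hn : r + b + c + (r + d) = n)
    (t : Fin r) (i : Fin m) (h : (Fin m → Finset (Fin n)) → Finset (Fin n) → ℝ) :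
    trapAverage (r + b + c) (b + 2) i h =
      (∑ g : Fin m → Position r b c d ≃ Fin n, h (insideSets g) (trapOf t (g i))) /
        Fintype.card (Fin m → Position r b c d ≃ Fin n) := by
  let G := Fin m → Position r b c d ≃ Fin n
  set s := r + b + c with hs
  obtain ⟨g₀⟩ := nonempty_arrangement (m := m) (r := r) (b := b) (c := c) (d := d) hn
  let act (g : G) : (Fin m → Equiv.Perm (Fin n)) ≃ G :=
    { toFun := fun τ j => (g j).trans (τ j)
      invFun := fun g' j => (g j).symm.trans (g' j)
      left_inv := fun τ => by funext j; ext; simp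
      right_inv := fun g' => by funext j; ext; simp }
  -- Independent relabellings of the universe act simply transitively on arrangements, so the sum
  -- over the orbit of any pair is the same sum over all arrangements.
  have hact : ∀ p ∈ trapPairs n m s (b + 2) i,
      ∑ τ : Fin m → Equiv.Perm (Fin n), h (permuteSets τ p.1) (p.2.map (τ i).toEmbedding) =
        ∑ g : G, h (insideSets g) (trapOf t (g i)) := by
    intro p hp
    obtain ⟨hp1, hp2⟩ := mem_trapPairs.1 hp
    obtain ⟨g, hg1, hg2⟩ := exists_arrangement hn t hp1 hp2
    rw [← Equiv.sum_comp (act g)]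
    refine Finset.sum_congr rfl fun τ _ => ?_
    rw [← hg1, ← hg2]
    congr 1
    · funext j
      simp only [permuteSets, insideSets, Finset.map_map]
      rfl
    · simp only [trapOf, Finset.map_map]
      rfl
  have hτ : Fintype.card (Fin m → Equiv.Perm (Fin n)) = Fintype.card G :=
    Fintype.card_congr (act g₀)
  -- Double counting over pairs and relabellings: a fixed relabelling merely permutes the pairs.
  have hdc : ((trapPairs n m s (b + 2) i).card : ℝ) *
      ∑ g : G, h (insideSets g) (trapOf t (g i)) =
      Fintype.card G * ∑ p ∈ trapPairs n m s (b + 2) i, h p.1 p.2 := by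
    rw [← nsmul_eq_mul, ← Finset.sum_const, ← Finset.sum_congr rfl hact, Finset.sum_comm,
      Finset.sum_congr rfl fun τ _ => sum_trapPairs_permute i τ h, Finset.sum_const,
      Finset.card_univ, nsmul_eq_mul, hτ]
  let T := (trapSets n (b + 2) (insideSets g₀ i)).card
  have hS₀ := insideSets_mem_aliceInputs g₀
  have hT : ∀ S ∈ aliceInputs n m s, (trapSets n (b + 2) (S i)).card = T := fun S hS =>
    card_trapSets_eq _ (by rw [mem_aliceInputs.1 hS, mem_aliceInputs.1 hS₀])
  have hT0 : (0 : ℝ) < T := by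
    exact_mod_cast Finset.card_pos.2 (trapSets_nonempty hn t (mem_aliceInputs.1 hS₀ i))
  have hX : (0 : ℝ) < (aliceInputs n m s).card := by
    exact_mod_cast Finset.card_pos.2 ⟨_, hS₀⟩
  have hpairs : ((trapPairs n m s (b + 2) i).card : ℝ) = (aliceInputs n m s).card * T := by
    have := sum_trapPairs (n := n) (s := s) (ℓ := b + 2) i fun _ _ => 1
    simp only [Finset.sum_const, nsmul_eq_mul, mul_one] at this
    rw [this, Finset.sum_congr rfl fun S hS => by rw [hT S hS]]
    simp
  have hG : (0 : ℝ) < Fintype.card G := by exact_mod_cast Fintype.card_pos_iff.2 ⟨g₀⟩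
  rw [trapAverage, Finset.sum_congr rfl fun S hS => by rw [hT S hS], ← Finset.sum_div,
    ← sum_trapPairs, div_div, div_eq_div_iff (by positivity) hG.ne', mul_comm, ← hdc, hpairs]
  ring

theorem trapAverage_mono {n m s ℓ : ℕ} {i : Fin m}
    {h h' : (Fin m → Finset (Fin n)) → Finset (Fin n) → ℝ}
    (H : ∀ S ∈ aliceInputs n m s, ∀ E ∈ trapSets n ℓ (S i), h S E ≤ h' S E) :
    trapAverage s ℓ i h ≤ trapAverage s ℓ i h' := by
  unfold trapAverage
  gcongr with S hS E hE
  exact H S hS E hE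

theorem trapAverage_add {n m s ℓ : ℕ} {i : Fin m}
    (h h' : (Fin m → Finset (Fin n)) → Finset (Fin n) → ℝ) :
    trapAverage s ℓ i (fun S E => h S E + h' S E) =
      trapAverage s ℓ i h + trapAverage s ℓ i h' := by
  simp only [trapAverage, Finset.sum_add_distrib, add_div]

theorem trapAverage_sum {n m s ℓ : ℕ} {i : Fin m} {ι : Type*} (J : Finset ι)
    (h : ι → (Fin m → Finset (Fin n)) → Finset (Fin n) → ℝ) :
    trapAverage s ℓ i (fun S E => ∑ j ∈ J, h j S E) = ∑ j ∈ J, trapAverage s ℓ i (h j) := by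
  classical
  induction J using Finset.induction_on with
  | empty => simp [trapAverage]
  | insert a J ha ih => simp only [Finset.sum_insert ha, trapAverage_add, ih]

/-! ## Tail bounds for the hard distribution -/

theorem card_subsetsOfCard (n s : ℕ) : (subsetsOfCard n s).card = n.choose s := by
  have : subsetsOfCard n s = Finset.powersetCard s Finset.univ := by
    ext A
    simp [subsetsOfCard, Finset.mem_powersetCard]
  rw [this, Finset.card_powersetCard, Finset.card_univ, Fintype.card_fin]

/-- The ratio of the binomials is the product of (s - i) / (n - i) over i < k, and each factor is at
most s / n. -/
theorem choose_sub_mul_pow_le {n s : ℕ} (hs : s ≤ n) (k : ℕ) (hk : k ≤ s) :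
    (n - k).choose (s - k) * n ^ k ≤ n.choose s * s ^ k := by
  induction k with
  | zero => simp
  | succ k ih =>
    obtain ⟨a, rfl⟩ : ∃ a, s = k + 1 + a := ⟨s - (k + 1), by omega⟩
    obtain ⟨q, rfl⟩ : ∃ q, n = k + 1 + a + q := ⟨n - (k + 1 + a), by omega⟩
    have e1 : k + 1 + a + q - k = a + q + 1 := by omega
    have e2 : k + 1 + a - k = a + 1 := by omega
    have e3 : k + 1 + a + q - (k + 1) = a + q := by omega
    have e4 : k + 1 + a - (k + 1) = a := by omega
    have ih := ih (by omega)
    rw [e1, e2] at ih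
    rw [e3, e4]
    have h := Nat.add_one_mul_choose_eq (a + q) a
    have h2 : (a + 1) * (k + 1 + a + q) ≤ (k + 1 + a) * (a + q + 1) := by nlinarith
    refine Nat.le_of_mul_le_mul_left ?_ (show 0 < a + q + 1 by omega)
    calc (a + q + 1) * ((a + q).choose a * (k + 1 + a + q) ^ (k + 1))
        = (a + q + 1).choose (a + 1) * (k + 1 + a + q) ^ k * ((a + 1) * (k + 1 + a + q)) := by
          rw [← mul_assoc, h]; ring
      _ ≤ (k + 1 + a + q).choose (k + 1 + a) * (k + 1 + a) ^ k * ((k + 1 + a) * (a + q + 1)) :=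
          Nat.mul_le_mul ih h2
      _ = _ := by ring

/-- A random `s`-subset contains a given set `D` with probability at most `(s / n) ^ |D|`. -/
theorem card_filter_superset_le {n s : ℕ} (hs : s ≤ n) (hn : 0 < n) (D : Finset (Fin n)) :
    (((subsetsOfCard n s).filter fun B => D ⊆ B).card : ℝ) ≤
      ((s : ℝ) / n) ^ D.card * (subsetsOfCard n s).card := by
  have h1 : ((subsetsOfCard n s).filter fun B => D ⊆ B).card ≤
      (Finset.powersetCard (s - D.card) Dᶜ).card := by
    refine Finset.card_le_card_of_injOn (fun B => B \ D) (fun B hB => ?_) fun B hB B' hB' h => ?_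
    · simp only [Finset.coe_filter, mem_subsetsOfCard, Set.mem_ofPred_eq] at hB
      simp only [Finset.mem_coe, Finset.mem_powersetCard, Finset.card_sdiff_of_subset hB.2, hB.1]
      exact ⟨fun x hx => by simpa using (Finset.mem_sdiff.1 hx).2, trivial⟩
    · simp only [Finset.coe_filter, Set.mem_ofPred_eq] at hB hB'
      rw [← Finset.sdiff_union_of_subset hB.2, ← Finset.sdiff_union_of_subset hB'.2]
      exact congrArg (· ∪ D) h
  by_cases hD : D.card ≤ s
  · rw [Finset.card_powersetCard, Finset.card_compl, Fintype.card_fin] at h1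
    have h2 := choose_sub_mul_pow_le hs _ hD
    rw [card_subsetsOfCard, div_pow, div_mul_eq_mul_div, le_div_iff₀ (by positivity)]
    have h3 : ((subsetsOfCard n s).filter fun B => D ⊆ B).card * n ^ D.card ≤
        s ^ D.card * n.choose s :=
      (Nat.mul_le_mul_right _ h1).trans (h2.trans (mul_comm _ _).le)
    exact_mod_cast h3
  · have : (subsetsOfCard n s).filter (fun B => D ⊆ B) = ∅ := by
      refine Finset.filter_false_of_mem fun B hB h => hD ?_
      exact (Finset.card_le_card h).trans (mem_subsetsOfCard.1 hB).le
    rw [this, Finset.card_empty, Nat.cast_zero]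
    positivity

theorem card_filter_notMem_le {n s : ℕ} (hs : s ≤ n) (e : Fin n) :
    (((subsetsOfCard n s).filter fun B => e ∉ B).card : ℝ) ≤
      (1 - (s : ℝ) / n) * (subsetsOfCard n s).card := by
  obtain ⟨k, rfl⟩ : ∃ k, n = k + 1 := ⟨n - 1, by have := e.pos; omega⟩
  have : (subsetsOfCard (k + 1) s).filter (fun B => e ∉ B) =
      Finset.powersetCard s (Finset.univ.erase e) := by
    ext B
    simp only [Finset.mem_filter, mem_subsetsOfCard, Finset.mem_powersetCard, Finset.subset_erase,
      Finset.subset_univ, true_and, and_comm]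
  rw [this, Finset.card_powersetCard, Finset.card_erase_of_mem (Finset.mem_univ e),
    Finset.card_univ, Fintype.card_fin, Nat.add_sub_cancel, card_subsetsOfCard]
  have h := Nat.choose_mul_succ_eq k s
  have h' : (k.choose s : ℝ) * (k + 1) = (k + 1).choose s * (k + 1 - s) := by
    have := congrArg (Nat.cast (R := ℝ)) h
    push_cast [Nat.cast_sub hs] at this
    exact this
  have hk : (0 : ℝ) < k + 1 := by positivity
  refine le_of_eq ?_
  push_cast
  field_simp
  linarith

/-- Exponential Markov: 4^|B ∩ E| is the sum of 3^|D| over D ⊆ B ∩ E, and D ⊆ B has probability at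
most (s / n)^|D|, so the mean is at most (1 + 3 s / n)^|E|. -/
theorem card_filter_inter_le {n s : ℕ} (hs : s ≤ n) (hn : 0 < n) (E : Finset (Fin n)) (u : ℝ) :
    (((subsetsOfCard n s).filter fun B => u < (B ∩ E).card).card : ℝ) ≤
      (1 + 3 * ((s : ℝ) / n)) ^ E.card / 4 ^ u * (subsetsOfCard n s).card := by
  have h4 : (0 : ℝ) < 4 ^ u := by positivity
  rw [div_mul_eq_mul_div, le_div_iff₀ h4]
  have h : ∀ k : ℕ, (4 : ℝ) ^ (k : ℕ) = (3 + 1) ^ k := by norm_num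
  calc (((subsetsOfCard n s).filter fun B => u < (B ∩ E).card).card : ℝ) * 4 ^ u
      = ∑ B ∈ (subsetsOfCard n s).filter fun B => u < (B ∩ E).card, (4 : ℝ) ^ u := by simp
    _ ≤ ∑ B ∈ (subsetsOfCard n s).filter fun B => u < (B ∩ E).card, (4 : ℝ) ^ (B ∩ E).card := by
        refine Finset.sum_le_sum fun B hB => ?_
        rw [← Real.rpow_natCast]
        exact Real.rpow_le_rpow_of_exponent_le (by norm_num) (Finset.mem_filter.1 hB).2.le
    _ ≤ ∑ B ∈ subsetsOfCard n s, (4 : ℝ) ^ (B ∩ E).card :=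
        Finset.sum_le_sum_of_subset_of_nonneg (Finset.filter_subset _ _)
          fun _ _ _ => by positivity
    _ = ∑ B ∈ subsetsOfCard n s, ∑ D ∈ E.powerset, if D ⊆ B then (3 : ℝ) ^ D.card else 0 := by
        refine Finset.sum_congr rfl fun B _ => ?_
        rw [h, ← Finset.sum_pow_mul_eq_add_pow, ← Finset.sum_filter]
        refine Finset.sum_congr ?_ fun D _ => by simp
        ext D
        simp only [Finset.mem_powerset, Finset.mem_filter, Finset.subset_inter_iff, and_comm]
    _ = ∑ D ∈ E.powerset, 3 ^ D.card *
          (((subsetsOfCard n s).filter fun B => D ⊆ B).card : ℝ) := by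
        rw [Finset.sum_comm]
        refine Finset.sum_congr rfl fun D _ => ?_
        rw [← Finset.sum_filter, Finset.sum_const, nsmul_eq_mul, mul_comm]
    _ ≤ ∑ D ∈ E.powerset, 3 ^ D.card *
          (((s : ℝ) / n) ^ D.card * (subsetsOfCard n s).card) := by
        gcongr with D hD
        exact card_filter_superset_le hs hn D
    _ = (1 + 3 * ((s : ℝ) / n)) ^ E.card * (subsetsOfCard n s).card := by
        rw [add_comm (1 : ℝ), ← Finset.sum_pow_mul_eq_add_pow, Finset.sum_mul]
        refine Finset.sum_congr rfl fun D _ => ?_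
        rw [mul_pow]
        ring

/-- The sets other than the `i`-th one are independent of the `i`-th one and of the trap. -/
theorem trapAverage_forall_le {n m s ℓ : ℕ} (i : Fin m)
    (K : Finset (Fin n) → Finset (Fin n) → Fin m → Finset (Fin n) → Prop) (ρ : Fin m → ℝ)
    (hK : ∀ A E, E ∈ trapSets n ℓ A → ∀ j,
      ∑ B ∈ subsetsOfCard n s, truthValue (K A E j B) ≤ ρ j * (subsetsOfCard n s).card) (hρ : ∀ j, 0 ≤ ρ j) :
    trapAverage s ℓ i (fun S E =>
      truthValue (∀ j ≠ i, K (S i) E j (S j))) ≤ ∏ j ∈ Finset.univ.erase i, ρ j := by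
  classical
  set Y := subsetsOfCard n s with hY
  have hcard : ((aliceInputs n m s).card : ℝ) = Y.card * ∏ _j ∈ Finset.univ.erase i, (Y.card : ℝ) := by
    rw [aliceInputs, Fintype.card_piFinset, Nat.cast_prod, Finset.mul_prod_erase _ (fun _ => (Y.card : ℝ))
      (Finset.mem_univ i)]
  have hcount : ∀ A ∈ Y, ∀ E ∈ trapSets n ℓ A,
      ((((aliceInputs n m s).filter fun S => S i = A).filter
        fun S => ∀ j ≠ i, K A E j (S j)).card : ℝ) ≤
      ∏ j ∈ Finset.univ.erase i, (ρ j * Y.card) := by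
    intro A hA E hE
    -- With `S i` and the trap fixed, the condition concerns each other coordinate separately, so
    -- the tuples form a product.
    have : ((aliceInputs n m s).filter fun S => S i = A).filter
        (fun S => ∀ j ≠ i, K A E j (S j)) =
        Fintype.piFinset fun j => if j = i then {A} else Y.filter fun B => K A E j B := by
      ext S
      simp only [Finset.mem_filter, aliceInputs, Fintype.mem_piFinset]
      constructor
      · rintro ⟨⟨h1, h2⟩, h3⟩ j
        by_cases h : j = i
        · subst h; simp [h2]
        · simpa [h, h3 j h] using h1 j
      · intro h
        have hi : S i = A := by simpa using h i
        refine ⟨⟨fun j => ?_, hi⟩, fun j hj => ?_⟩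
        · by_cases hj : j = i
          · subst hj; rwa [hi]
          · have := h j
            simp only [hj, if_false, Finset.mem_filter] at this
            exact this.1
        · have := h j
          simp only [hj, if_false, Finset.mem_filter] at this
          exact this.2
    rw [this, Fintype.card_piFinset, Nat.cast_prod, ← Finset.mul_prod_erase _ _ (Finset.mem_univ i)]
    simp only [if_true, Finset.card_singleton, Nat.cast_one, one_mul]
    refine Finset.prod_le_prod (fun j _ => by positivity) fun j hj => ?_
    rw [if_neg (Finset.ne_of_mem_erase hj)]
    exact (sum_truthValue _ _).symm.trans_le (hK A E hE j)
  have hR : 0 ≤ ∏ j ∈ Finset.univ.erase i, ρ j := Finset.prod_nonneg fun j _ => hρ j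
  refine div_le_of_le_mul₀ (by positivity) hR ?_
  have hmaps : ∀ S ∈ aliceInputs n m s, S i ∈ Y := fun S hS => Fintype.mem_piFinset.1 hS i
  rw [← Finset.sum_fiberwise_of_maps_to hmaps]
  calc _ ≤ ∑ A ∈ Y, ∏ j ∈ Finset.univ.erase i, (ρ j * Y.card) := by
        refine Finset.sum_le_sum fun A hA => ?_
        have hP : 0 ≤ ∏ j ∈ Finset.univ.erase i, (ρ j * (Y.card : ℝ)) :=
          Finset.prod_nonneg fun j _ => mul_nonneg (hρ j) (Nat.cast_nonneg _)
        calc _ = (∑ E ∈ trapSets n ℓ A,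
              ∑ S ∈ (aliceInputs n m s).filter fun S => S i = A,
                truthValue (∀ j ≠ i, K A E j (S j))) / (trapSets n ℓ A).card := by
              rw [Finset.sum_comm, Finset.sum_div]
              refine Finset.sum_congr rfl fun S hS => ?_
              simp only [(Finset.mem_filter.1 hS).2]
          _ ≤ _ := by
              refine div_le_of_le_mul₀ (by positivity) hP ?_
              rw [mul_comm, ← nsmul_eq_mul, ← Finset.sum_const]
              refine Finset.sum_le_sum fun E hE => ?_
              rw [sum_truthValue]
              exact hcount A hA E hE
    _ = _ := by
        rw [Finset.sum_const, nsmul_eq_mul, Finset.prod_mul_distrib, hcard]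
        ring

/-- It is unlikely that no other set contains the outside element of the trap. -/
theorem trapAverage_uncovered_le {n m s ℓ : ℕ} (hs : s ≤ n) (i : Fin m) :
    trapAverage (n := n) s ℓ i (fun S E => truthValue (∀ j ≠ i, Disjoint (E \ S i) (S j))) ≤
      (1 - (s : ℝ) / n) ^ (m - 1) := by
  have h0 : 0 ≤ 1 - (s : ℝ) / n :=
    sub_nonneg.2 (div_le_one_of_le₀ (by exact_mod_cast hs) (Nat.cast_nonneg _))
  refine (trapAverage_forall_le i (fun A E _ B => Disjoint (E \ A) B) (fun _ => 1 - (s : ℝ) / n)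
    (fun A E hE _ => ?_) fun _ => h0).trans (le_of_eq ?_)
  · obtain ⟨e, he⟩ := Finset.card_eq_one.1 (mem_trapSets.1 hE).2
    simp only [he, Finset.disjoint_singleton_left, sum_truthValue]
    exact card_filter_notMem_le hs e
  · rw [Finset.prod_const, Finset.card_erase_of_mem (Finset.mem_univ i), Finset.card_univ,
      Fintype.card_fin]

/-- It is unlikely that another set contains a large part of the trap. -/
theorem trapAverage_overlap_le {n m s ℓ : ℕ} (hs : s ≤ n) (hn : 0 < n) (i : Fin m) (u : ℝ) :
    trapAverage (n := n) s ℓ i (fun S E => truthValue (∃ j ≠ i, u < (S j ∩ E).card)) ≤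
      m * ((1 + 3 * ((s : ℝ) / n)) ^ ℓ / 4 ^ u) := by
  set q := (1 + 3 * ((s : ℝ) / n)) ^ ℓ / (4 : ℝ) ^ u with hq
  have hq0 : 0 ≤ q := by positivity
  -- A union bound over `j₀`; the event for one `j₀` is written as a condition on all coordinates,
  -- vacuous except at `j₀`, to fit `trapAverage_forall_le`.
  calc _ ≤ trapAverage (n := n) s ℓ i (fun S E => ∑ j₀ ∈ Finset.univ.erase i,
          truthValue (∀ j ≠ i, j = j₀ → u < (S j ∩ E).card)) := by
        refine trapAverage_mono fun S _ E _ => ?_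
        by_cases h : ∃ j ≠ i, u < (S j ∩ E).card
        · obtain ⟨j, hj, hu⟩ := h
          refine le_trans (le_of_eq ?_) (Finset.single_le_sum (fun k _ => truthValue_nonneg _)
            (Finset.mem_erase.2 ⟨hj, Finset.mem_univ j⟩))
          rw [truthValue_of ⟨j, hj, hu⟩, truthValue_of]
          rintro k - rfl
          exact hu
        · rw [truthValue_of_not h]
          exact Finset.sum_nonneg fun _ _ => truthValue_nonneg _
    _ = ∑ j₀ ∈ Finset.univ.erase i, trapAverage (n := n) s ℓ i (fun S E =>
          truthValue (∀ j ≠ i, j = j₀ → u < (S j ∩ E).card)) := trapAverage_sum _ _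
    _ ≤ ∑ _j₀ ∈ Finset.univ.erase i, q := by
        refine Finset.sum_le_sum fun j₀ hj₀ => ?_
        refine (trapAverage_forall_le i (fun _ E j B => j = j₀ → u < (B ∩ E).card)
          (fun j => if j = j₀ then q else 1) (fun A E hE j => ?_) fun j => ?_).trans
          (le_of_eq ?_)
        · by_cases h : j = j₀
          · simp only [h, if_true, forall_const, sum_truthValue]
            rw [hq, ← (mem_trapSets.1 hE).1]
            exact card_filter_inter_le hs hn E u
          · simp [h, truthValue_of]
        · positivity
        · rw [Finset.prod_ite_eq' _ _ _, if_pos hj₀]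
    _ ≤ m * q := by
        rw [Finset.sum_const, nsmul_eq_mul]
        refine mul_le_mul_of_nonneg_right ?_ hq0
        exact_mod_cast (Finset.card_le_univ _).trans (by simp)

/-! ## From set cover to traps -/

theorem trapAverage_one {m n r b c d : ℕ} (hn : r + b + c + (r + d) = n) (t : Fin r)
    (i : Fin m) : trapAverage (n := n) (r + b + c) (b + 2) i (fun _ _ => 1) = 1 := by
  rw [trapAverage_eq_sum_arrangements hn t]
  have := nonempty_arrangement (m := m) hn
  have hG : (Fintype.card (Fin m → Position r b c d ≃ Fin n) : ℝ) ≠ 0 := by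
    exact_mod_cast Fintype.card_ne_zero
  rw [Finset.sum_const, Finset.card_univ, nsmul_eq_mul, mul_one, div_self hG]

/-- If the message about the input allows to guess a half of a random trap that contains the outside
element with probability at least `1 / 2 + ε`, then there are many messages. -/
theorem le_log_card_messages {m n r b c d : ℕ} (hn : r + b + c + (r + d) = n) {κ : Type*}
    (W : (Fin m → Finset (Fin n)) → κ) (M : Finset κ)
    (hW : ∀ S ∈ aliceInputs n m (r + b + c), W S ∈ M)
    (L : κ → Fin m → Finset (Fin n) → Finset (Fin n))
    (hL : ∀ w i E, L w i E ⊆ E ∧ 2 * (L w i E).card ≤ E.card) {ε : ℝ} (hε : 0 ≤ ε)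
    (h : m * (1 / 2 + ε) ≤ ∑ i : Fin m, trapAverage (r + b + c) (b + 2) i
      fun S E => truthValue (E \ S i ⊆ L (W S) i E)) :
    ε ^ 2 * (m * r) / 2 ≤ Real.log M.card := by
  let G := Fin m → Position r b c d ≃ Fin n
  have := nonempty_arrangement (m := m) hn
  have hG : (0 : ℝ) < Fintype.card G := by exact_mod_cast Fintype.card_pos
  let adv (i : Fin m) (t : Fin r) : ℝ :=
    ∑ g : G, guessAdvantage (g i) t (L (W (insideSets g)) i (trapOf t (g i)))
  -- The parameter `ε` is optimal for an average total advantage of m r ε: it leaves ε² m r / 2 for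
  -- the logarithm.
  have hup := sum_guessAdvantage_le (d := d) W M (fun g => hW _ (insideSets_mem_aliceInputs g)) L ε
  have hadv : ∑ g : G, ∑ i, ∑ t,
      guessAdvantage (g i) t (L (W (insideSets g)) i (trapOf t (g i))) = ∑ i, ∑ t, adv i t := by
    rw [Finset.sum_comm]
    exact Finset.sum_congr rfl fun i _ => Finset.sum_comm
  rw [hadv] at hup
  have hlow : ∀ i t, ((b : ℝ) + 2) * (Fintype.card G * (trapAverage (r + b + c) (b + 2) i
      (fun S E => truthValue (E \ S i ⊆ L (W S) i E)) - 1 / 2)) ≤ (b + 1) * adv i t := by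
    intro i t
    refine le_of_eq_of_le ?_
      (le_sum_guessAdvantage i t (fun S E => L (W S) i E) fun S E => hL _ _ _)
    rw [trapAverage_eq_sum_arrangements hn t, mul_sub, mul_div_cancel₀ _ hG.ne',
      Finset.sum_sub_distrib, Finset.sum_const, Finset.card_univ, nsmul_eq_mul]
    congr 2
    refine Finset.sum_congr rfl fun g _ => ?_
    simp only [trapOf_sdiff_insideSets, Finset.singleton_subset_iff, truthValue_eq_ite]
  have hsum := Finset.sum_le_sum fun i (_ : i ∈ Finset.univ) =>
    Finset.sum_le_sum fun t (_ : t ∈ Finset.univ) => hlow i t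
  simp only [← Finset.mul_sum, Finset.sum_const, Finset.card_univ, Fintype.card_fin,
    nsmul_eq_mul, Finset.sum_sub_distrib] at hsum
  set A := ∑ i, ∑ t, adv i t
  set p := ∑ i : Fin m, trapAverage (r + b + c) (b + 2) i
    fun S E => truthValue (E \ S i ⊆ L (W S) i E)
  have hA : Fintype.card G * (r * (m * ε)) ≤ A := by
    have h1 : (m : ℝ) * ε ≤ p - m * (1 / 2) := by linarith
    have h2 : (0 : ℝ) ≤ Fintype.card G * (r * (m * ε)) := by positivity
    have h3 : Fintype.card G * (r * (m * ε)) ≤ Fintype.card G * (r * (p - m * (1 / 2))) := by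
      gcongr
    have hb : (0 : ℝ) ≤ b := Nat.cast_nonneg b
    have h4 : ((b : ℝ) + 2) * (Fintype.card G * (r * (p - m * (1 / 2)))) ≤ (b + 1) * A := by
      refine le_of_eq_of_le ?_ hsum
      ring
    have h5 : ((b : ℝ) + 1) * (Fintype.card G * (r * (m * ε))) ≤ (b + 1) * A := by
      nlinarith
    exact le_of_mul_le_mul_left h5 (by positivity)
  have hfin : Fintype.card G * (ε * (r * (m * ε))) ≤
      Fintype.card G * (Real.log M.card + ε ^ 2 * (m * r : ℕ) / 2) := by
    refine le_trans ?_ hup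
    rw [mul_left_comm]
    exact mul_le_mul_of_nonneg_left hA hε
  have := le_of_mul_le_mul_left hfin hG
  push_cast at this
  linarith

/-- The guess for the trap `E` of the `i`-th set that the answer `z` to set cover suggests: the
elements that are not certified to be covered by the `i`-th set. -/
def trapGuess {n m : ℕ} (z : Finset (Option (Fin m)) × (Fin n → Option (Fin m))) (i : Fin m)
    (E : Finset (Fin n)) : Finset (Fin n) :=
  if 2 * (E.filter fun e => z.2 e ≠ some i).card ≤ E.card then E.filter fun e => z.2 e ≠ some i
  else ∅

theorem trapGuess_subset_and_card_le {n m : ℕ}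
    (z : Finset (Option (Fin m)) × (Fin n → Option (Fin m))) (i : Fin m) (E : Finset (Fin n)) :
    trapGuess z i E ⊆ E ∧ 2 * (trapGuess z i E).card ≤ E.card := by
  unfold trapGuess
  split_ifs with h
  · exact ⟨Finset.filter_subset _ _, h⟩
  · simp

theorem setCoverOpt_le_three {n m : ℕ} {S : Fin m → Finset (Fin n)} {E : Finset (Fin n)}
    {i j : Fin m} (h : ∀ e ∈ E, e ∉ S i → e ∈ S j) : setCoverOpt (jointFamily S Eᶜ) ≤ 3 := by
  classical
  have hC : IsSetCover (jointFamily S Eᶜ) {none, some i, some j} := fun e => by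
    by_cases he : e ∈ E
    · by_cases hi : e ∈ S i
      · exact ⟨some i, by simp, hi⟩
      · exact ⟨some j, by simp, h e he hi⟩
    · exact ⟨none, by simp, by simpa [jointFamily] using he⟩
  have hle : setCoverOpt (jointFamily S Eᶜ) ≤ _ := Nat.sInf_le ⟨_, hC, rfl⟩
  exact hle.trans Finset.card_le_three

/-- At most 3α sets are chosen, each one other than S_i covers at most `u` elements of the trap, and
Bob's set covers none. Hence at most 3αu elements are certified outside S_i, and the outside element
is among them. -/
theorem sdiff_subset_trapGuess {n m : ℕ} {α u : ℝ} (hα : 0 ≤ α) (hu : 0 ≤ u)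
    {S : Fin m → Finset (Fin n)} {i : Fin m} {E : Finset (Fin n)}
    (hE : E ∈ trapSets n ⌊2 * (3 * α) * u⌋₊ (S i))
    {z : Finset (Option (Fin m)) × (Fin n → Option (Fin m))} (hz : SetCoverApx n m α S Eᶜ z)
    (hcov : ¬ ∀ j ≠ i, Disjoint (E \ S i) (S j)) (hover : ¬ ∃ j ≠ i, u < (S j ∩ E).card) :
    E \ S i ⊆ trapGuess z i E := by
  classical
  obtain ⟨hEc, hE1⟩ := mem_trapSets.1 hE
  obtain ⟨e₀, he₀⟩ := Finset.card_eq_one.1 hE1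
  push Not at hcov hover
  obtain ⟨j, hj, hjd⟩ := hcov
  rw [he₀, Finset.disjoint_singleton_left, not_not] at hjd
  have hopt : setCoverOpt (jointFamily S Eᶜ) ≤ 3 := by
    refine setCoverOpt_le_three (i := i) (j := j) fun e he hei => ?_
    have : e ∈ E \ S i := Finset.mem_sdiff.2 ⟨he, hei⟩
    rw [he₀, Finset.mem_singleton] at this
    rwa [this]
  obtain ⟨C, f⟩ := z
  obtain ⟨hC, hf⟩ := hz
  simp only at hC hf
  have hC3 : (C.card : ℝ) ≤ 3 * α := by
    have : (setCoverOpt (jointFamily S Eᶜ) : ℝ) ≤ 3 := by exact_mod_cast hopt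
    nlinarith
  set L := E.filter fun e => f e ≠ some i with hLdef
  have hLsub : L ⊆ (C.filter fun k => k ≠ some i).biUnion fun k =>
      E.filter fun e => k ≠ none ∧ e ∈ jointFamily S Eᶜ k := by
    intro e he
    obtain ⟨heE, hei⟩ := Finset.mem_filter.1 he
    refine Finset.mem_biUnion.2 ⟨f e, Finset.mem_filter.2 ⟨(hf e).1, hei⟩,
      Finset.mem_filter.2 ⟨heE, fun hnone => ?_, (hf e).2⟩⟩
    have := (hf e).2
    rw [hnone] at this
    simp [jointFamily, heE] at this
  have hLcard : (L.card : ℝ) ≤ 3 * α * u := by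
    calc (L.card : ℝ) ≤ ∑ k ∈ C.filter (fun k => k ≠ some i),
          ((E.filter fun e => k ≠ none ∧ e ∈ jointFamily S Eᶜ k).card : ℝ) := by
          exact_mod_cast (Finset.card_le_card hLsub).trans Finset.card_biUnion_le
      _ ≤ ∑ k ∈ C.filter (fun k => k ≠ some i), u := by
          refine Finset.sum_le_sum fun k hk => ?_
          rcases k with _ | k
          · simpa using hu
          · have hki : k ≠ i := fun h => (Finset.mem_filter.1 hk).2 (by rw [h])
            refine le_of_eq_of_le ?_ (hover k hki)
            congr 2
            ext e
            simp [jointFamily, and_comm]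
      _ ≤ C.card * u := by
          rw [Finset.sum_const, nsmul_eq_mul]
          gcongr
          exact Finset.filter_subset _ _
      _ ≤ 3 * α * u := by gcongr
  have h2 : 2 * L.card ≤ E.card := by
    rw [hEc]
    -- The left side is an integer, so rounding the trap size 6αu down costs nothing.
    refine Nat.le_floor ?_
    push_cast
    linarith
  have hguess : trapGuess (C, f) i E = L := if_pos h2
  rw [hguess]
  intro e he
  obtain ⟨heE, hei⟩ := Finset.mem_sdiff.1 he
  refine Finset.mem_filter.2 ⟨heE, fun h => hei ?_⟩
  have := (hf e).2
  rw [h] at this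
  exact this

/-- The cost of a protocol for set cover on the hard distribution is large when the bad inputs are
rare. -/
theorem le_of_cost_le {m n r b c d k : ℕ} {α δ ε : ℝ} (hn : r + b + c + (r + d) = n) (hr : 0 < r)
    (hm : 0 < m) (hα : 0 ≤ α) (hδ : 0 ≤ δ) (hε : 0 ≤ ε)
    (hs : ⌊(n : ℝ) / (10 * (3 * α))⌋₊ = r + b + c)
    (hℓ : ⌊2 * (3 * α) * Real.logb 2 m⌋₊ = b + 2)
    (hbad : (1 - ((r + b + c : ℕ) : ℝ) / n) ^ (m - 1) +
      m * ((1 + 3 * (((r + b + c : ℕ) : ℝ) / n)) ^ (b + 2) / 4 ^ Real.logb 2 m) ≤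
      1 / 2 - δ - ε)
    (π : OneWayProtocol (Fin m → Finset (Fin n)) (Finset (Fin n))
      (Finset (Option (Fin m)) × (Fin n → Option (Fin m))))
    (herr : π.error (SetCoverApx n m α) (Dapx n m (3 * α)) ≤ ENNReal.ofReal δ)
    (hcost : π.cost (Dapx n m (3 * α)) ≤ k) :
    ε ^ 2 * (m * r) / 2 ≤ (k + 1) * Real.log 2 := by
  classical
  set s := r + b + c with hsdef
  have hsn : s ≤ n := by omega
  have hn0 : 0 < n := by omega
  let t₀ : Fin r := ⟨0, hr⟩
  have hT : ∀ A : Finset (Fin n), A.card = s → (trapSets n (b + 2) A).Nonempty :=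
    fun A hA => trapSets_nonempty hn t₀ hA
  have hX : (aliceInputs n m s).Nonempty := by
    obtain ⟨g⟩ := nonempty_arrangement (m := m) hn
    exact ⟨_, insideSets_mem_aliceInputs g⟩
  obtain ⟨ω, hω⟩ := π.exists_run_error_le (SetCoverApx n m α) (Dapx n m (3 * α))
  set Q := {p : (Fin m → Finset (Fin n)) × Finset (Fin n) |
    ¬ SetCoverApx n m α p.1 p.2 (π.run p.1 p.2 ω)} with hQ
  have havg := hω.trans herr
  rw [tsum_Dapx_mul_indicator hs hℓ hm hX hT, ENNReal.ofReal_le_ofReal_iff hδ] at havg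
  have hm' : (0 : ℝ) < m := by exact_mod_cast hm
  have herrsum : ∑ i : Fin m, trapAverage s (b + 2) i
      (fun S E => truthValue ((S, Eᶜ) ∈ Q)) ≤ m * δ := by
    refine le_trans (le_of_eq ?_) (mul_le_mul_of_nonneg_left havg hm'.le)
    simp only [trapAverage]
    rw [← Finset.sum_div, ← Finset.sum_div, Finset.sum_comm]
    field_simp
  have hmsg : ∀ S ∈ aliceInputs n m s, π.msg S ω.1 ω.2.1 ∈ shortStrings k := by
    intro S hS
    refine mem_shortStrings ?_
    let i₀ : Fin m := ⟨0, hm⟩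
    obtain ⟨E, hE⟩ := hT (S i₀) (mem_aliceInputs.1 hS i₀)
    have hsup := mem_support_Dapx hs hℓ hS hE
    have h1 : ((π.msg S ω.1 ω.2.1).length : ℕ∞) ≤ π.cost (Dapx n m (3 * α)) :=
      le_iSup₂_of_le (S, Eᶜ) hsup (le_iSup₂_of_le ω.1 ω.2.1 le_rfl)
    exact_mod_cast h1.trans hcost
  have hu : 0 ≤ Real.logb 2 m := Real.logb_nonneg (by norm_num) (by exact_mod_cast hm)
  -- Union bound: a failed guess forces a wrong answer or one of the two rare events.
  have hgood : ∀ i : Fin m, 1 - trapAverage s (b + 2) i (fun S E => truthValue ((S, Eᶜ) ∈ Q)) -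
      (1 / 2 - δ - ε) ≤ trapAverage s (b + 2) i fun S E => truthValue
        (E \ S i ⊆ trapGuess (π.out (π.msg S ω.1 ω.2.1) Eᶜ ω.1 ω.2.2) i E) := by
    intro i
    have h1 := trapAverage_mono (n := n) (s := s) (ℓ := b + 2) (i := i) (h := fun _ _ => 1)
      (h' := fun S E => truthValue
        (E \ S i ⊆ trapGuess (π.out (π.msg S ω.1 ω.2.1) Eᶜ ω.1 ω.2.2) i E) +
        (truthValue ((S, Eᶜ) ∈ Q) + (truthValue (∀ j ≠ i, Disjoint (E \ S i) (S j)) +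
          truthValue (∃ j ≠ i, Real.logb 2 m < (S j ∩ E).card)))) ?_
    · rw [trapAverage_one hn t₀, trapAverage_add, trapAverage_add, trapAverage_add] at h1
      have h2 := trapAverage_uncovered_le (ℓ := b + 2) hsn i
      have h3 := trapAverage_overlap_le (ℓ := b + 2) hsn hn0 i (Real.logb 2 m)
      linarith
    · intro S hS E hE
      have n1 := truthValue_nonneg (E \ S i ⊆
        trapGuess (π.out (π.msg S ω.1 ω.2.1) Eᶜ ω.1 ω.2.2) i E)
      have n2 := truthValue_nonneg ((S, Eᶜ) ∈ Q)
      have n3 := truthValue_nonneg (∀ j ≠ i, Disjoint (E \ S i) (S j))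
      have n4 := truthValue_nonneg (∃ j ≠ i, Real.logb 2 m < (S j ∩ E).card)
      by_cases c2 : (S, Eᶜ) ∈ Q
      · linarith [truthValue_of c2]
      by_cases c3 : ∀ j ≠ i, Disjoint (E \ S i) (S j)
      · linarith [truthValue_of c3]
      by_cases c4 : ∃ j ≠ i, Real.logb 2 m < (S j ∩ E).card
      · linarith [truthValue_of c4]
      have c1 : E \ S i ⊆ trapGuess (π.out (π.msg S ω.1 ω.2.1) Eᶜ ω.1 ω.2.2) i E :=
        sdiff_subset_trapGuess hα hu (hℓ ▸ hE) (not_not.1 c2) c3 c4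
      linarith [truthValue_of c1]
  have hmain := le_log_card_messages hn (fun S => π.msg S ω.1 ω.2.1) (shortStrings k) hmsg
    (fun w i E => trapGuess (π.out w Eᶜ ω.1 ω.2.2) i E)
    (fun w i E => trapGuess_subset_and_card_le _ _ _) hε ?_
  · refine hmain.trans ?_
    obtain ⟨S, hS⟩ := hX
    have hpos : (0 : ℝ) < (shortStrings k).card := by
      exact_mod_cast Finset.card_pos.2 ⟨_, hmsg S hS⟩
    have hle : ((shortStrings k).card : ℝ) ≤ 2 ^ (k + 1) := by
      exact_mod_cast card_shortStrings_le k
    refine (Real.log_le_log hpos hle).trans (le_of_eq ?_)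
    rw [Real.log_pow]
    push_cast
    ring
  · have hsum := Finset.sum_le_sum fun i (_ : i ∈ Finset.univ) => hgood i
    rw [Finset.sum_sub_distrib, Finset.sum_sub_distrib, Finset.sum_const, Finset.sum_const,
      Finset.card_univ, Fintype.card_fin, nsmul_eq_mul, nsmul_eq_mul] at hsum
    linarith

/-! ## Asymptotics -/

theorem one_sub_pow_le_exp {p x : ℝ} {m : ℕ} (hp : p ≤ 1) (hm : 2 ≤ m)
    (hx : x ≤ p * m / 2) (hp0 : 0 ≤ p) : (1 - p) ^ (m - 1) ≤ Real.exp (-x) := by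
  have h1 : (1 - p) ^ (m - 1) ≤ Real.exp (-p) ^ (m - 1) :=
    pow_le_pow_left₀ (by linarith) (Real.one_sub_le_exp_neg p) _
  refine h1.trans ?_
  rw [← Real.exp_nat_mul, Real.exp_le_exp, Nat.cast_sub (by omega)]
  have : (2 : ℝ) ≤ m := by exact_mod_cast hm
  push_cast
  nlinarith

/-- Since 4^(log₂ m) = m² and 3pℓ ≤ 0.6 log₂ m ≤ 0.9 log m, the left side is at most m^(-1/10). -/
theorem mul_pow_div_rpow_logb_le {a p x : ℝ} {m ℓ : ℕ} (ha : 0 < a) (hm : 0 < m) (hp0 : 0 ≤ p)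
    (hp : p ≤ 1 / (30 * a)) (hℓ : (ℓ : ℝ) ≤ 6 * a * Real.logb 2 m)
    (hx : x ≤ Real.log m / 10) (hlog : 0 ≤ Real.log m) :
    m * ((1 + 3 * p) ^ ℓ / 4 ^ Real.logb 2 m) ≤ Real.exp (-x) := by
  have hm' : (0 : ℝ) < m := by exact_mod_cast hm
  have h4 : (4 : ℝ) ^ Real.logb 2 m = m ^ 2 := by
    rw [show (4 : ℝ) = 2 ^ (2 : ℝ) by norm_num, ← Real.rpow_mul (by norm_num), mul_comm,
      Real.rpow_mul (by norm_num), Real.rpow_logb (by norm_num) (by norm_num) hm']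
    norm_num
  have h1 : (1 + 3 * p) ^ ℓ ≤ Real.exp (0.6 * Real.logb 2 m) := by
    have : (1 + 3 * p) ^ ℓ ≤ Real.exp (3 * p) ^ ℓ := by
      refine pow_le_pow_left₀ (by positivity) ?_ _
      linarith [Real.add_one_le_exp (3 * p)]
    refine this.trans ?_
    rw [← Real.exp_nat_mul, Real.exp_le_exp]
    have hu := (Nat.cast_nonneg ℓ).trans hℓ
    calc (ℓ : ℝ) * (3 * p) ≤ (6 * a * Real.logb 2 m) * (3 * (1 / (30 * a))) := by gcongr
      _ = 0.6 * Real.logb 2 m := by field_simp; ring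
  have h2 : 0.6 * Real.logb 2 m ≤ 0.9 * Real.log m := by
    rw [Real.logb, ← mul_div_assoc, div_le_iff₀ (Real.log_pos (by norm_num))]
    nlinarith [Real.log_two_gt_d9]
  rw [h4]
  calc m * ((1 + 3 * p) ^ ℓ / m ^ 2) = (1 + 3 * p) ^ ℓ / m := by field_simp
    _ ≤ Real.exp (0.9 * Real.log m) / m := by
        gcongr
        exact h1.trans (Real.exp_le_exp.2 h2)
    _ = Real.exp (0.9 * Real.log m - Real.log m) := by rw [Real.exp_sub, Real.exp_log hm']
    _ ≤ Real.exp (-x) := Real.exp_le_exp.2 (by linarith)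

/-- The numerical conditions on `n`, `m` and `a` under which the lower bound holds. -/
theorem ofReal_le_oneWayCC {n m : ℕ} {a δ ε x : ℝ} (ha : 1 ≤ a) (hδ : 0 ≤ δ) (hε : 0 < ε)
    (hm : 2 ≤ m) (hn : 60 * a ≤ n) (hlen : 1440 * a ^ 2 * Real.log m ≤ n)
    (hcov : x ≤ m / (120 * a)) (hover : x ≤ Real.log m / 10)
    (hx : 2 * Real.exp (-x) ≤ 1 / 2 - δ - ε) (hbig : 1 ≤ ε ^ 2 / 720 * (m * n / a)) :
    ENNReal.ofReal (ε ^ 2 / 720 * (m * n / a)) ≤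
      (oneWayCC (SetCoverApx n m a) (Dapx n m (3 * a)) δ : ℝ≥0∞) := by
  have ha0 : 0 < a := by linarith
  have hn0 : (0 : ℝ) < n := by linarith
  have hm' : (2 : ℝ) ≤ m := by exact_mod_cast hm
  set s := ⌊(n : ℝ) / (10 * (3 * a))⌋₊ with hs
  set ℓ := ⌊2 * (3 * a) * Real.logb 2 m⌋₊ with hℓ
  have hlog : 0 ≤ Real.log m := Real.log_nonneg (by linarith)
  have hlb1 : 1 ≤ Real.logb 2 m := by
    rw [Real.le_logb_iff_rpow_le (by norm_num) (by linarith)]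
    simpa using hm'
  have hlb2 : Real.logb 2 m ≤ 2 * Real.log m := by
    rw [Real.logb, div_le_iff₀ (Real.log_pos (by norm_num))]
    nlinarith [Real.log_two_gt_d9]
  have hsle : (s : ℝ) ≤ n / (30 * a) := by
    refine (Nat.floor_le (by positivity)).trans (le_of_eq ?_)
    ring
  -- As n / (30 a) ≥ 2, rounding down loses at most half.
  have hsge : (n : ℝ) / (60 * a) ≤ s := by
    have h1 := (Nat.lt_floor_add_one ((n : ℝ) / (10 * (3 * a)))).le
    have h2 : (1 : ℝ) ≤ n / (60 * a) := by rwa [le_div_iff₀ (by positivity), one_mul]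
    have h3 : (n : ℝ) / (10 * (3 * a)) = n / (60 * a) + n / (60 * a) := by field_simp; norm_num
    rw [h3] at h1
    simp only [hs, h3]
    linarith
  have hℓle : (ℓ : ℝ) ≤ 6 * a * Real.logb 2 m := by
    refine (Nat.floor_le (by positivity)).trans (le_of_eq ?_)
    ring
  have hℓ2 : 2 ≤ ℓ := by
    refine Nat.le_floor ?_
    push_cast
    nlinarith
  have hℓs : 2 * ℓ ≤ s := by
    have h : (2 * ℓ : ℝ) ≤ s := by
      refine le_trans ?_ hsge
      rw [le_div_iff₀ (by positivity)]
      calc 2 * (ℓ : ℝ) * (60 * a) ≤ 2 * (6 * a * (2 * Real.log m)) * (60 * a) := by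
            gcongr
            exact hℓle.trans (by gcongr)
        _ = 1440 * a ^ 2 * Real.log m := by ring
        _ ≤ n := hlen
    exact_mod_cast h
  have hsn : 2 * s ≤ n := by
    have h : (2 * s : ℝ) ≤ n := by
      have : (n : ℝ) / (30 * a) ≤ n / 2 := by gcongr; linarith
      linarith
    exact_mod_cast h
  -- Half of the inside positions go to pairs, r = s / 2; `hℓs` leaves room for the `b` shared
  -- positions and `hsn` for the outside partners.
  obtain ⟨b, hb⟩ : ∃ b, ℓ = b + 2 := ⟨ℓ - 2, by omega⟩
  obtain ⟨c, hc⟩ : ∃ c, s = s / 2 + b + c := ⟨s - s / 2 - b, by omega⟩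
  obtain ⟨d, hd⟩ : ∃ d, s + (s / 2 + d) = n := ⟨n - s - s / 2, by omega⟩
  have hr : (n : ℝ) / (180 * a) ≤ (s / 2 : ℕ) := by
    have h1 : s ≤ 3 * (s / 2) := by omega
    have h2 : (s : ℝ) ≤ 3 * (s / 2 : ℕ) := by exact_mod_cast h1
    have h3 : (n : ℝ) / (60 * a) = 3 * (n / (180 * a)) := by field_simp; norm_num
    linarith
  have hp1 : (s : ℝ) / n ≤ 1 / (30 * a) := by
    rw [div_le_iff₀ hn0]
    refine hsle.trans (le_of_eq ?_)
    ring
  have hp2 : 1 / (60 * a) ≤ (s : ℝ) / n := by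
    rw [le_div_iff₀ hn0]
    refine le_trans (le_of_eq ?_) hsge
    ring
  have hp3 : (s : ℝ) / n ≤ 1 := hp1.trans (by rw [div_le_one (by positivity)]; linarith)
  have hp0 : 0 ≤ (s : ℝ) / n := by positivity
  have hb1 := one_sub_pow_le_exp (x := x) hp3 hm (hcov.trans (by
    calc (m : ℝ) / (120 * a) = 1 / (60 * a) * m / 2 := by field_simp; norm_num
      _ ≤ s / n * m / 2 := by gcongr)) hp0
  have hb2 := mul_pow_div_rpow_logb_le ha0 (by omega) hp0 hp1 hℓle hover hlog
  set X := ε ^ 2 / 720 * (m * n / a) with hX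
  have hceil : (⌈X⌉₊ : ℕ∞) ≤ oneWayCC (SetCoverApx n m a) (Dapx n m (3 * a)) δ := by
    refine le_iInf₂ fun π hπ => ?_
    by_contra! hlt
    obtain ⟨k, hk⟩ := ENat.ne_top_iff_exists.1 (hlt.trans (ENat.natCast_lt_top _)).ne
    rw [← hk, Nat.cast_lt, Nat.lt_ceil] at hlt
    have hfin := le_of_cost_le (r := s / 2) (b := b) (c := c) (d := d) (k := k) (α := a) (δ := δ)
      (ε := ε) (m := m) (n := n) (by rw [← hc, hd]) (by omega) (by omega) ha0.le hδ hε.le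
      (by rw [← hc]) (by rw [← hb]) (by rw [← hc, ← hb]; linarith) π hπ hk.symm.le
    have h1 : (k + 1) * Real.log 2 ≤ k + 1 := by
      have : (0 : ℝ) ≤ k := Nat.cast_nonneg k
      nlinarith [Real.log_two_lt_d9]
    -- The constant 720 = 4 · 180 leaves a factor 2, which absorbs rounding: k < X and 1 ≤ X give k
    -- + 1 < 2X.
    have h2 : 2 * X ≤ ε ^ 2 * (m * (s / 2 : ℕ)) / 2 := by
      calc 2 * X = ε ^ 2 * (m * (n / (180 * a))) / 2 := by rw [hX]; field_simp; norm_num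
        _ ≤ _ := by gcongr
    linarith
  calc ENNReal.ofReal X ≤ ENNReal.ofReal (⌈X⌉₊ : ℝ) := ENNReal.ofReal_le_ofReal (Nat.le_ceil X)
    _ = ((⌈X⌉₊ : ℕ∞) : ℝ≥0∞) := by simp
    _ ≤ _ := ENat.toENNReal_le.2 hceil

theorem mainTheorem5 (δ : ℝ) (hδ₀ : 0 < δ) (hδ : δ < 1 / 2) :
    ∃ c : ℝ, 0 < c ∧
      ∀ (α : ℕ → ℝ) (m : ℕ → ℕ),
        (∀ᶠ n in atTop, 1 ≤ α n) →
        (α =o[atTop] fun n : ℕ => √(n : ℝ) / Real.log n) →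
        (∃ k : ℕ, (fun n : ℕ => (m n : ℝ)) =O[atTop] fun n : ℕ => (n : ℝ) ^ k) →
        ((fun n : ℕ => α n * Real.log n) =O[atTop] fun n : ℕ => (m n : ℝ)) →
        ∀ᶠ n : ℕ in atTop,
          ENNReal.ofReal (c * ((m n : ℝ) * n / α n)) ≤
            (oneWayCC (SetCoverApx n (m n) (α n)) (Dapx n (m n) (3 * α n)) δ : ℝ≥0∞) := by
  -- Half of the gap 1/2 - δ is the guessing advantage; the other half pays for the two rare events,
  -- each of probability at most exp (-x) = ε / 2.
  obtain ⟨ε, hε⟩ : ∃ ε, ε = (1 / 2 - δ) / 2 := ⟨_, rfl⟩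
  have hε0 : 0 < ε := by linarith
  refine ⟨ε ^ 2 / 720, by positivity, fun α m hα hαo hmO hmΩ => ?_⟩
  obtain ⟨k, hmO⟩ := hmO
  obtain ⟨K, hK0, hK⟩ := hmO.exists_pos
  obtain ⟨B, hB0, hB⟩ := hmΩ.exists_pos
  obtain ⟨x, hx⟩ : ∃ x, x = Real.log (2 / ε) := ⟨_, rfl⟩
  have hexp : 2 * Real.exp (-x) = ε := by
    rw [hx, Real.exp_neg, Real.exp_log (by positivity)]
    field_simp
  -- Small enough that α log n ≤ η √n gives 1440 α² log m ≤ n, where log m ≤ (k + 1) log n.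
  obtain ⟨η, hη0, hη⟩ : ∃ η : ℝ, 0 < η ∧ η ^ 2 * (1440 * (k + 1)) ≤ 1 := by
    refine ⟨1 / (1440 * (k + 1)), by positivity, ?_⟩
    rw [div_pow, one_pow, sq, div_mul_eq_mul_div, one_mul, div_self_mul_self',
      inv_le_one_iff₀]
    right
    have : (0 : ℝ) ≤ k := Nat.cast_nonneg k
    linarith
  have hlogT : Tendsto (fun n : ℕ => Real.log n) atTop atTop :=
    Real.tendsto_log_atTop.comp tendsto_natCast_atTop_atTop
  filter_upwards [hα, hαo.bound hη0, hK.bound, hB.bound, eventually_gt_atTop 0,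
    hlogT.eventually_ge_atTop 1, hlogT.eventually_ge_atTop (Real.log K),
    hlogT.eventually_ge_atTop (2 * B), hlogT.eventually_ge_atTop (120 * B * x),
    hlogT.eventually_ge_atTop (B * Real.exp (10 * x)),
    hlogT.eventually_ge_atTop (B * (720 / ε ^ 2))] with n ha hαn hmK hmB hn hl1 hlK hl2 hlx hle hlε
  have hn0 : (0 : ℝ) < n := by exact_mod_cast hn
  have hn1 : (1 : ℝ) ≤ n := by exact_mod_cast hn
  have ha0 : 0 < α n := by linarith
  have hl0 : 0 < Real.log n := by linarith
  set l := Real.log n with hl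
  set a := α n
  rw [Real.norm_of_nonneg (by positivity), Real.norm_of_nonneg (by positivity)] at hαn hmK hmB
  have hal : a * l ≤ η * √n := by
    rwa [← mul_div_assoc, le_div_iff₀ hl0] at hαn
  have hal2 : a ^ 2 * l ^ 2 ≤ η ^ 2 * n := by
    have := pow_le_pow_left₀ (by positivity) hal 2
    rwa [mul_pow, mul_pow, Real.sq_sqrt hn0.le] at this
  have hlm : l ≤ B * m n := (le_mul_of_one_le_left hl0.le ha).trans hmB
  have hm2 : (2 : ℝ) ≤ m n := by
    have : B * 2 ≤ B * m n := by linarith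
    exact le_of_mul_le_mul_left this hB0
  have hlogm : Real.log (m n) ≤ (k + 1) * l := by
    have h1 := Real.log_le_log (by linarith) hmK
    rw [Real.log_mul hK0.ne' (by positivity), Real.log_pow] at h1
    linarith
  have hal3 : 1440 * (k + 1) * (a ^ 2 * l ^ 2) ≤ n := by
    calc 1440 * (k + 1) * (a ^ 2 * l ^ 2) ≤ 1440 * (k + 1) * (η ^ 2 * n) := by gcongr
      _ = (η ^ 2 * (1440 * (k + 1))) * n := by ring
      _ ≤ 1 * n := by gcongr
      _ = n := one_mul _
  have hk0 : (0 : ℝ) ≤ k := Nat.cast_nonneg k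
  have hll : l ≤ l ^ 2 := le_self_pow₀ hl1 two_ne_zero
  refine ofReal_le_oneWayCC (x := x) ha hδ₀.le hε0 (by exact_mod_cast hm2) ?_ ?_ ?_ ?_ ?_ ?_
  · have h1 : a ≤ a ^ 2 * l ^ 2 := (le_self_pow₀ ha two_ne_zero).trans
      (le_mul_of_one_le_right (by positivity) (one_le_pow₀ hl1))
    calc 60 * a ≤ 1440 * (0 + 1) * a := by linarith
      _ ≤ 1440 * (k + 1) * (a ^ 2 * l ^ 2) := by gcongr
      _ ≤ n := hal3
  · calc 1440 * a ^ 2 * Real.log (m n) ≤ 1440 * a ^ 2 * ((k + 1) * l ^ 2) := by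
          gcongr
          exact hlogm.trans (by gcongr)
      _ = 1440 * (k + 1) * (a ^ 2 * l ^ 2) := by ring
      _ ≤ n := hal3
  -- The hypothesis on `m` makes m / α at least (log n) / B, hence unbounded.
  · rw [le_div_iff₀ (by positivity)]
    have h1 : a * (120 * B * x) ≤ a * l := by gcongr
    have h2 : B * (x * (120 * a)) ≤ B * m n := by linarith
    exact le_of_mul_le_mul_left h2 hB0
  · have h1 : Real.exp (10 * x) ≤ m n :=
      le_of_mul_le_mul_left (hle.trans hlm) hB0
    have h2 := Real.log_le_log (Real.exp_pos _) h1
    rw [Real.log_exp] at h2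
    linarith
  · linarith
  · have h1 : 720 / ε ^ 2 ≤ m n / a := by
      rw [le_div_iff₀ ha0]
      have h2 : a * (B * (720 / ε ^ 2)) ≤ a * l := by gcongr
      have h3 : B * (720 / ε ^ 2 * a) ≤ B * m n := by linarith
      exact le_of_mul_le_mul_left h3 hB0
    calc (1 : ℝ) = ε ^ 2 / 720 * (720 / ε ^ 2 * 1) := by field_simp
      _ ≤ ε ^ 2 / 720 * (m n / a * n) := by gcongr
      _ = ε ^ 2 / 720 * (m n * n / a) := by ring
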